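/- For $\mathbf x=(x,y)\in\mathbb R^2\setminus\{0\}$ put $\mathbf x^{-\perp}=(-y,x)/(x^2+y^2)$. For $\alpha\in\mathbb R$ consider on $\mathbb R^4\ni(\mathbf x_1,\mathbf x_2)$ the magnetic momenta $$D_1=-i\nabla_{\mathbf x_1}+\alpha(\mathbf x_1-\mathbf x_2)^{-\perp},\qquad D_2=-i\nabla_{\mathbf x_2}+\alpha(\mathbf x_2-\mathbf x_1)^{-\perp},$$ and let $\mathscr D_\alpha^2\subset L^2_{\mathrm{sym}}(\mathbb R^4)$ be the domain of the closure in $L^2$ of $(D_1,D_2)$, initially defined on the smooth complex-valued functions that are symmetric under $\mathbf x_1\leftrightarrow\mathbf x_2$ and compactly supported in $\mathbb R^4\setminus\{\mathbf x_1=\mathbf x_2\}$. With $Q_0=[0,1]^2$, let $$E_2^{N}(\alpha)=\inf\Bigl\{\sum_{j=1}^2\int_{Q_0^2}|D_j\Psi|^2\ :\ \Psi\in\mathscr D_\alpha^2,\ \int_{Q_0^2}|\Psi|^2=1\Bigr\}$$ be the Neumann ground-state energy of two anyons with statistics parameter $\alpha$ on the unit square. Then $$E_2^{N}(\alpha)=4\pi\alpha\bigl(1+O(\alpha^{1/3})\bigr)\qquad\text{as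 }\alpha\to0^+.$$ -/

import Mathlib

open MeasureTheory Filter Topology Asymptotics
open scoped ContDiff

noncomputable section

namespace Anyon

/-- The plane `ℝ²`, with points `(x, y)` and Lebesgue measure. -/
abbrev Plane : Type := ℝ × ℝ

/-- The configuration space `(ℝ²)^N`, with Lebesgue measure. -/
abbrev Config (N : ℕ) : Type := Fin N → Plane

/-- The Aharonov–Bohm potential `𝐱^{-⊥} = (-y, x) / (x² + y²)`. -/
def perpInv (p : Plane) : Plane :=
  (-p.2 / (p.1 ^ 2 + p.2 ^ 2), p.1 / (p.1 ^ 2 + p.2 ^ 2))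

/-- The magnetic potential `𝐀_j(𝐱₁, …, 𝐱_N) = ∑_{k ≠ j} (𝐱_j - 𝐱_k)^{-⊥}` seen by particle `j`. -/
def vecPot {N : ℕ} (j : Fin N) (x : Config N) : Plane :=
  ∑ k ∈ Finset.univ.erase j, perpInv (x j - x k)

/-- The two standard unit vectors of the plane. -/
def unitVec (c : Fin 2) : Plane := ![(1, 0), (0, 1)] c

/-- The two components of a vector in the plane. -/
def component (c : Fin 2) (p : Plane) : ℝ := ![p.1, p.2] c

/-- The `c`-th component of `D_j Ψ = (-i ∇_{𝐱_j} + α 𝐀_j) Ψ`, for a smooth `Ψ`. -/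
def momentum {N : ℕ} (α : ℝ) (j : Fin N) (c : Fin 2) (Ψ : Config N → ℂ) (x : Config N) : ℂ :=
  -Complex.I * fderiv ℝ Ψ x (Pi.single j (unitVec c))
    + ((α * component c (vecPot j x) : ℝ) : ℂ) * Ψ x

/-- The set of configurations in which at least two particles coincide. -/
def diagonals (N : ℕ) : Set (Config N) :=
  {x | ∃ j k : Fin N, j ≠ k ∧ x j = x k}

/-- Permutation-symmetric, smooth functions with compact support in `ℝ^{2N}` minus the diagonals. -/
structure IsCore {N : ℕ} (φ : Config N → ℂ) : Prop where
  smooth : ContDiff ℝ ∞ φ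
  compact : HasCompactSupport φ
  off_diagonal : Disjoint (tsupport φ) (diagonals N)
  symmetric : ∀ (σ : Equiv.Perm (Fin N)) (x : Config N), φ (x ∘ σ) = φ x

/-- `(Ψ, Φ)` lies in the graph of the operator `𝖣_α = (D_j)_j` on `L²_sym(ℝ^{2N})`, i.e. in the
`L²`-closure of the graph of `𝖣_α` on symmetric test functions supported away from the diagonals.
So `Ψ` is in the form domain and `Φ j c` is (almost everywhere) the `c`-th component of `D_j Ψ`. -/
structure InGraph {N : ℕ} (α : ℝ) (Ψ : Config N → ℂ) (Φ : Fin N → Fin 2 → Config N → ℂ) :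
    Prop where
  memLp : MemLp Ψ 2 volume
  memLp_momentum : ∀ j c, MemLp (Φ j c) 2 volume
  approx : ∃ φ : ℕ → Config N → ℂ, (∀ n, IsCore (φ n)) ∧
    Tendsto (fun n => eLpNorm (φ n - Ψ) 2 volume) atTop (𝓝 0) ∧
    ∀ j c, Tendsto (fun n => eLpNorm (momentum α j c (φ n) - Φ j c) 2 volume) atTop (𝓝 0)

/-- The product domain `Ω^N` in configuration space. -/
def power (N : ℕ) (Ω : Set Plane) : Set (Config N) := Set.univ.pi fun _ => Ω

/-- The Neumann ground-state energy `E_N^N(α; Ω)`: the infimum of `∑_j ∫_{Ω^N} |D_j Ψ|²` over all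
`Ψ` in the domain of `𝖣_α` with `∫_{Ω^N} |Ψ|² = 1`. -/
def neumannEnergyOn (N : ℕ) (α : ℝ) (Ω : Set Plane) : ℝ :=
  sInf {e : ℝ | ∃ (Ψ : Config N → ℂ) (Φ : Fin N → Fin 2 → Config N → ℂ),
    InGraph α Ψ Φ ∧ ∫ x in power N Ω, ‖Ψ x‖ ^ 2 = 1 ∧
    e = ∑ j, ∫ x in power N Ω, ∑ c, ‖Φ j c x‖ ^ 2}

/-- The unit square `Q₀ = [0,1]²`. -/
def unitSquare : Set Plane := Set.Icc 0 1 ×ˢ Set.Icc 0 1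

/-- The Neumann ground-state energy `E_N^N(α)` of `N` anyons on the unit square. -/
def neumannEnergy (N : ℕ) (α : ℝ) : ℝ := neumannEnergyOn N α unitSquare

end Anyon

end

/-! Fix one particle and place its Aharonov–Bohm flux at the origin for the other. The heuristic is
that for small `α` the modulus of a low-energy state is nearly constant while the flux costs `2πα`
per particle, hence `4πα` for the pair.

Lower bound. In polar coordinates about the flux the angular energy is at least `α²/ρ²`
(`angular_lower_bound`). Completing a square in the radial variable turns this singular potential
into the constant `2α/R²` on a disc of radius `R` (`radial_lower_bound`, `hardy_disc`); its total
strength `(2α/R²)·πR² = 2πα` does not depend on `R`. It remains to compare the mean of `|Ψ|²` over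
the disc with its mean over the square. By the diamagnetic inequality the oscillation of `|Ψ|` along
horizontal and vertical lines is controlled by the same energy (`mean_sq_unitSquare_le`), with
Young's inequality of parameter `δ`. The disc must fit in the square, so the other particle is first
confined to an inner square; exchange symmetry and a second comparison of means remove this
restriction (`pair_lower_bound`). The relative errors are of order `δ`, `R` and `α/(δR)`, besides
the smaller `α/δ`, and `δ = R = α^{1/3}` balances the first three. The estimate is proved on test
functions and passes to the closure of the graph by `L²` continuity.

Upper bound. The function `|𝐱₁ - 𝐱₂|^α` has energy density `2α²|𝐱₁ - 𝐱₂|^{2α-2}` per particle, whose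
integral over a disc of radius `r` is `2πα r^{2α}`; for small `α` the radius is immaterial. A cutoff
near the diagonal at squared distance `ε` costs `O(ε^α)`, negligible once `ε` is tiny, and the norm
tends to one because `α^α → 1`. -/

noncomputable section

namespace Anyon

/-! ### One-dimensional inequalities: diamagnetic, angular and radial -/

/-- The Cauchy–Schwarz inequality for the integral of a continuous function on an interval. -/
lemma sq_integral_le {g : ℝ → ℝ} (hg : Continuous g) {a b : ℝ} (hab : a ≤ b) :
    (∫ s in a..b, g s) ^ 2 ≤ (b - a) * ∫ s in a..b, g s ^ 2 := by
  set m := ∫ s in a..b, g s with hm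
  -- Expanding this square gives `b - a` times the claim, so an interval of length zero is treated
  -- separately.
  have h0 : 0 ≤ ∫ s in a..b, ((b - a) * g s - m) ^ 2 :=
    intervalIntegral.integral_nonneg hab fun s _ => sq_nonneg _
  have h1 : ∫ s in a..b, ((b - a) * g s - m) ^ 2
      = (b - a) ^ 2 * (∫ s in a..b, g s ^ 2) - 2 * (b - a) * m * m + (b - a) * m ^ 2 := by
    have : ∀ s, ((b - a) * g s - m) ^ 2
        = (b - a) ^ 2 * g s ^ 2 - 2 * (b - a) * m * g s + m ^ 2 := fun s => by ring
    simp_rw [this]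
    rw [intervalIntegral.integral_add, intervalIntegral.integral_sub,
      intervalIntegral.integral_const_mul, intervalIntegral.integral_const_mul,
      intervalIntegral.integral_const, ← hm, smul_eq_mul]
    all_goals exact (by fun_prop : Continuous _).intervalIntegrable _ _
  rcases hab.eq_or_lt with rfl | hlt
  · simp [hm]
  · have : 0 ≤ (b - a) * ((b - a) * (∫ s in a..b, g s ^ 2) - m ^ 2) := by
      rw [h1] at h0; nlinarith
    have := nonneg_of_mul_nonneg_right this (sub_pos.2 hlt)
    linarith

/-- The diamagnetic inequality along a line. -/
lemma abs_norm_sub_norm_le {F F' : ℝ → ℂ} {A : ℝ → ℝ} (hF : ∀ s, HasDerivAt F (F' s) s)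
    (hF' : Continuous F') (hc : Continuous fun s => -Complex.I * F' s + (A s : ℂ) * F s)
    {a b : ℝ} (hab : a ≤ b) :
    |‖F b‖ - ‖F a‖| ≤ ∫ s in a..b, ‖-Complex.I * F' s + (A s : ℂ) * F s‖ := by
  have hFc : Continuous F := continuous_iff_continuousAt.2 fun s => (hF s).continuousAt
  refine le_of_forall_pos_le_add fun ε hε => ?_
  set η := ε / 2 with hη
  have hη0 : 0 < η := by positivity
  -- `‖F‖` need not be differentiable at the zeros of `F`; this regularization is, and differs from
  -- `‖F‖` by at most `η`.
  set u : ℝ → ℝ := fun s => √(‖F s‖ ^ 2 + η ^ 2) with hu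
  have hpos : ∀ s, 0 < ‖F s‖ ^ 2 + η ^ 2 := fun s => by positivity
  have hupos : ∀ s, 0 < u s := fun s => Real.sqrt_pos.2 (hpos s)
  have husq : ∀ s, u s ^ 2 = ‖F s‖ ^ 2 + η ^ 2 := fun s => Real.sq_sqrt (hpos s).le
  have hFu : ∀ s, ‖F s‖ ≤ u s := fun s => Real.le_sqrt_of_sq_le (by nlinarith [sq_nonneg η])
  have huF : ∀ s, u s ≤ ‖F s‖ + η := fun s =>
    Real.sqrt_le_iff.2 ⟨by positivity, by nlinarith [norm_nonneg (F s)]⟩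
  set u' : ℝ → ℝ := fun s => (2 * inner ℝ (F s) (F' s)) / (2 * u s) with hu'
  have hder : ∀ s, HasDerivAt u (u' s) s := fun s => by
    have := ((hF s).norm_sq.add_const (η ^ 2)).sqrt (hpos s).ne'
    exact this
  have huc : Continuous u := by fun_prop
  have hu'c : Continuous u' := by
    refine Continuous.div (by fun_prop) (by fun_prop) fun s => ?_
    have := hupos s
    positivity
  have hbound : ∀ s, ‖u' s‖ ≤ ‖-Complex.I * F' s + (A s : ℂ) * F s‖ := fun s => by
    set z := -Complex.I * F' s + (A s : ℂ) * F s with hz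
    -- The potential drops out: `i z = F' + i A F`, and `i A F` is orthogonal to `F` over the reals.
    have h1 : inner ℝ (F s) (F' s) = inner ℝ (F s) (Complex.I * z) := by
      simp only [Complex.inner, hz, Complex.mul_re, Complex.mul_im, Complex.add_re, Complex.add_im,
        Complex.conj_re, Complex.conj_im, Complex.I_re, Complex.I_im, Complex.neg_re,
        Complex.neg_im, Complex.ofReal_re, Complex.ofReal_im]
      ring
    have h2 : |inner ℝ (F s) (F' s)| ≤ ‖F s‖ * ‖z‖ := by
      rw [h1]
      refine (abs_real_inner_le_norm _ _).trans ?_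
      simp
    have h3 : u' s = inner ℝ (F s) (F' s) / u s := by
      simp only [hu']
      exact mul_div_mul_left _ _ two_ne_zero
    rw [h3, norm_div, Real.norm_eq_abs, Real.norm_eq_abs, abs_of_pos (hupos s),
      div_le_iff₀ (hupos s)]
    nlinarith [hFu s, norm_nonneg z]
  have hint : ∫ s in a..b, u' s = u b - u a :=
    intervalIntegral.integral_eq_sub_of_hasDerivAt (fun s _ => hder s)
      (hu'c.intervalIntegrable _ _)
  have h4 : |u b - u a| ≤ ∫ s in a..b, ‖-Complex.I * F' s + (A s : ℂ) * F s‖ := by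
    rw [← hint]
    refine (intervalIntegral.abs_integral_le_integral_abs hab).trans ?_
    exact intervalIntegral.integral_mono_on hab (hu'c.abs.intervalIntegrable _ _)
      (hc.norm.intervalIntegrable _ _) fun s _ => hbound s
  rw [abs_le] at h4 ⊢
  have := hFu a; have := hFu b; have := huF a; have := huF b
  constructor <;> linarith

/-- The potential does not enter the bound except through the magnetic derivative, so the modulus of
a magnetic state obeys the same oscillation estimate on a unit interval as a function with no field.
-/
lemma sq_norm_sub_norm_le {F F' : ℝ → ℂ} {A : ℝ → ℝ} (hF : ∀ s, HasDerivAt F (F' s) s)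
    (hF' : Continuous F') (hc : Continuous fun s => -Complex.I * F' s + (A s : ℂ) * F s)
    {a b : ℝ} (ha : a ∈ Set.Icc (0 : ℝ) 1) (hb : b ∈ Set.Icc (0 : ℝ) 1) :
    (‖F b‖ - ‖F a‖) ^ 2 ≤ ∫ s in (0 : ℝ)..1, ‖-Complex.I * F' s + (A s : ℂ) * F s‖ ^ 2 := by
  wlog hab : a ≤ b generalizing a b
  · rw [← neg_sub, neg_sq]
    exact this hb ha (le_of_not_ge hab)
  have h1 := abs_norm_sub_norm_le hF hF' hc hab
  have h2 : ∫ s in a..b, ‖-Complex.I * F' s + (A s : ℂ) * F s‖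
      ≤ ∫ s in (0 : ℝ)..1, ‖-Complex.I * F' s + (A s : ℂ) * F s‖ :=
    intervalIntegral.integral_mono_interval ha.1 hab hb.2
      (Eventually.of_forall fun s => norm_nonneg _) (hc.norm.intervalIntegrable _ _)
  have h3 := sq_integral_le hc.norm (zero_le_one (α := ℝ))
  rw [sub_zero, one_mul] at h3
  refine le_trans ?_ h3
  rw [← sq_abs]
  exact pow_le_pow_left₀ (abs_nonneg _) (h1.trans h2) 2

/-- For small flux the lowest eigenvalue of `(-i d/dθ + α)²` on the circle is `α²`. -/
lemma angular_lower_bound {F F' : ℝ → ℂ} (hF : ∀ s, HasDerivAt F (F' s) s)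
    (hF' : Continuous F') (hper : F (-Real.pi) = F Real.pi) {α : ℝ} (hα : 0 ≤ α)
    (hα' : α * (4 * Real.pi) ≤ 1) :
    α ^ 2 * ∫ s in -Real.pi..Real.pi, ‖F s‖ ^ 2
      ≤ ∫ s in -Real.pi..Real.pi, ‖-Complex.I * F' s + (α : ℂ) * F s‖ ^ 2 := by
  have hpi := Real.pi_pos
  have hle : -Real.pi ≤ Real.pi := by linarith
  have hFc : Continuous F := continuous_iff_continuousAt.2 fun s => (hF s).continuousAt
  set c := F (-Real.pi) with hc
  -- The constant `c` is split off in the cross term because, by periodicity, `F'` has mean zero;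
  -- what is left is quadratic in `F'`.
  have hexp : ∀ s, ‖-Complex.I * F' s + (α : ℂ) * F s‖ ^ 2
      = ‖F' s‖ ^ 2 + 2 * α * (F' s * starRingEnd ℂ (F s - c)).im
        + 2 * α * (F' s * starRingEnd ℂ c).im + α ^ 2 * ‖F s‖ ^ 2 := fun s => by
    simp only [Complex.sq_norm, Complex.normSq_apply, Complex.mul_re, Complex.mul_im,
      Complex.add_re, Complex.add_im, Complex.sub_re, Complex.sub_im, map_sub,
      Complex.conj_re, Complex.conj_im, Complex.I_re, Complex.I_im, Complex.neg_re,
      Complex.neg_im, Complex.ofReal_re, Complex.ofReal_im]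
    ring
  have hzero : ∫ s in -Real.pi..Real.pi, (F' s * starRingEnd ℂ c).im = 0 := by
    have h1 : ∫ s in -Real.pi..Real.pi, F' s = 0 := by
      rw [intervalIntegral.integral_eq_sub_of_hasDerivAt (fun s _ => hF s)
        (hF'.intervalIntegrable _ _), ← hper, sub_self]
    have h2 := Complex.imCLM.intervalIntegral_comp_comm
      ((hF'.mul continuous_const).intervalIntegrable (μ := volume) (-Real.pi) Real.pi
        : IntervalIntegrable (fun s => F' s * starRingEnd ℂ c) volume (-Real.pi) Real.pi)
    simp only [Complex.imCLM_apply, Pi.mul_apply] at h2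
    rw [h2, intervalIntegral.integral_mul_const, h1]
    simp
  set m := ∫ s in -Real.pi..Real.pi, ‖F' s‖ with hm
  have hm0 : 0 ≤ m := intervalIntegral.integral_nonneg hle fun s _ => norm_nonneg _
  have hosc : ∀ s ∈ Set.Icc (-Real.pi) Real.pi, ‖F s - c‖ ≤ m := fun s hs => by
    rw [hc, ← intervalIntegral.integral_eq_sub_of_hasDerivAt (fun s _ => hF s)
        (hF'.intervalIntegrable _ _)]
    refine (intervalIntegral.norm_integral_le_integral_norm hs.1).trans ?_
    exact intervalIntegral.integral_mono_interval le_rfl hs.1 hs.2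
      (Eventually.of_forall fun s => norm_nonneg _) (hF'.norm.intervalIntegrable _ _)
  have hcross : -(m * m) ≤ ∫ s in -Real.pi..Real.pi, (F' s * starRingEnd ℂ (F s - c)).im := by
    have h1 : ∫ s in -Real.pi..Real.pi, -(‖F' s‖ * m)
        ≤ ∫ s in -Real.pi..Real.pi, (F' s * starRingEnd ℂ (F s - c)).im := by
      refine intervalIntegral.integral_mono_on hle
        ((by fun_prop : Continuous _).intervalIntegrable _ _)
        ((Complex.continuous_im.comp (hF'.mul
          (Complex.continuous_conj.comp (hFc.sub continuous_const)))).intervalIntegrable _ _)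
        fun s hs => ?_
      have h2 := (abs_le.1 (Complex.abs_im_le_norm (F' s * starRingEnd ℂ (F s - c)))).1
      rw [norm_mul, RCLike.norm_conj] at h2
      nlinarith [hosc s hs, norm_nonneg (F' s)]
    rwa [intervalIntegral.integral_neg, intervalIntegral.integral_mul_const, ← hm] at h1
  have hcs := sq_integral_le hF'.norm hle
  rw [← hm] at hcs
  have hint : ∫ s in -Real.pi..Real.pi, ‖-Complex.I * F' s + (α : ℂ) * F s‖ ^ 2
      = (∫ s in -Real.pi..Real.pi, ‖F' s‖ ^ 2)
        + 2 * α * (∫ s in -Real.pi..Real.pi, (F' s * starRingEnd ℂ (F s - c)).im)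
        + 2 * α * 0 + α ^ 2 * ∫ s in -Real.pi..Real.pi, ‖F s‖ ^ 2 := by
    have c1 : Continuous fun s => (F' s * starRingEnd ℂ (F s - c)).im :=
      Complex.continuous_im.comp (hF'.mul (Complex.continuous_conj.comp (hFc.sub continuous_const)))
    have c2 : Continuous fun s => (F' s * starRingEnd ℂ c).im :=
      Complex.continuous_im.comp (hF'.mul continuous_const)
    simp_rw [hexp]
    rw [intervalIntegral.integral_add, intervalIntegral.integral_add, intervalIntegral.integral_add,
      intervalIntegral.integral_const_mul, intervalIntegral.integral_const_mul,
      intervalIntegral.integral_const_mul, hzero]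
    all_goals exact (by fun_prop : Continuous _).intervalIntegrable _ _
  rw [hint]
  have hD : 0 ≤ ∫ s in -Real.pi..Real.pi, ‖F' s‖ ^ 2 :=
    intervalIntegral.integral_nonneg hle fun s _ => sq_nonneg _
  -- The cross term is at least `-2α m² ≥ -4πα ∫ ‖F'‖²`, which `∫ ‖F'‖²` absorbs since `4πα ≤ 1`.
  nlinarith [mul_le_mul_of_nonneg_left hcross hα, mul_le_mul_of_nonneg_left hcs hα,
    mul_le_mul_of_nonneg_right hα' hD]

/-- The radial inequality replacing the potential `α²/ρ²` by a constant one on `ρ < R`. -/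
lemma radial_lower_bound {F F' : ℝ → ℂ} (hF : ∀ s, HasDerivAt F (F' s) s)
    (hF' : Continuous F') (h0 : F 0 = 0) {α R : ℝ} (hα : 0 ≤ α) (hR : 0 < R)
    (hc : Continuous fun s => ‖F s‖ ^ 2 / s) :
    2 * α / R ^ 2 * ∫ s in (0 : ℝ)..R, s * ‖F s‖ ^ 2
      ≤ ∫ s in (0 : ℝ)..R, (s * ‖F' s‖ ^ 2 + α ^ 2 * (‖F s‖ ^ 2 / s)) := by
  have hFc : Continuous F := continuous_iff_continuousAt.2 fun s => (hF s).continuousAt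
  -- The weight vanishes at `R` and `F` vanishes at `0`, so `v'` integrates to zero. Differentiating
  -- the weight produces the constant potential; the other term of `v'` is at most the weight times
  -- the energy, by completing a square.
  set v : ℝ → ℝ := fun s => (1 - s ^ 2 / R ^ 2) * (α * ‖F s‖ ^ 2) with hv
  set v' : ℝ → ℝ := fun s => (-(2 * s / R ^ 2)) * (α * ‖F s‖ ^ 2)
    + (1 - s ^ 2 / R ^ 2) * (α * (2 * inner ℝ (F s) (F' s))) with hv'
  have hder : ∀ s, HasDerivAt v (v' s) s := fun s => by
    have h1 : HasDerivAt (fun s : ℝ => 1 - s ^ 2 / R ^ 2) (-(2 * s / R ^ 2)) s := by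
      simpa using ((hasDerivAt_pow 2 s).div_const (R ^ 2)).const_sub 1
    exact h1.mul ((hF s).norm_sq.const_mul α)
  have hv'c : Continuous v' := by fun_prop
  have hint : ∫ s in (0 : ℝ)..R, v' s = 0 := by
    rw [intervalIntegral.integral_eq_sub_of_hasDerivAt (fun s _ => hder s)
      (hv'c.intervalIntegrable _ _)]
    simp [hv, h0, hR.ne']
  have hpt : ∀ s ∈ Set.Ioo 0 R, 2 * α / R ^ 2 * (s * ‖F s‖ ^ 2) + v' s
      ≤ s * ‖F' s‖ ^ 2 + α ^ 2 * (‖F s‖ ^ 2 / s) := fun s hs => by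
    have h1 : 0 ≤ s ^ 2 / R ^ 2 := by positivity
    have h2 : s ^ 2 / R ^ 2 ≤ 1 := by
      rw [div_le_one (by positivity)]
      exact pow_le_pow_left₀ hs.1.le hs.2.le 2
    have h3 : 2 * α * inner ℝ (F s) (F' s) ≤ s * ‖F' s‖ ^ 2 + α ^ 2 * (‖F s‖ ^ 2 / s) := by
      have h4 := real_inner_le_norm (F s) (F' s)
      have h5 : s * ‖F' s‖ ^ 2 + α ^ 2 * (‖F s‖ ^ 2 / s) - 2 * α * (‖F s‖ * ‖F' s‖)
          = (s * ‖F' s‖ - α * ‖F s‖) ^ 2 / s := by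
        have := hs.1.ne'
        field_simp
        ring
      have h6 : 0 ≤ (s * ‖F' s‖ - α * ‖F s‖) ^ 2 / s := div_nonneg (sq_nonneg _) hs.1.le
      nlinarith
    have h7 : 0 ≤ s * ‖F' s‖ ^ 2 + α ^ 2 * (‖F s‖ ^ 2 / s) := by
      have := hs.1
      positivity
    have h8 : (1 - s ^ 2 / R ^ 2) * (2 * α * inner ℝ (F s) (F' s))
        ≤ s * ‖F' s‖ ^ 2 + α ^ 2 * (‖F s‖ ^ 2 / s) := by
      nlinarith
    calc _ = (1 - s ^ 2 / R ^ 2) * (2 * α * inner ℝ (F s) (F' s)) := by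
          simp only [hv']; ring
      _ ≤ _ := h8
  calc 2 * α / R ^ 2 * ∫ s in (0 : ℝ)..R, s * ‖F s‖ ^ 2
      = ∫ s in (0 : ℝ)..R, (2 * α / R ^ 2 * (s * ‖F s‖ ^ 2) + v' s) := by
        rw [intervalIntegral.integral_add, hint, intervalIntegral.integral_const_mul, add_zero]
        all_goals exact (by fun_prop : Continuous _).intervalIntegrable _ _
    _ ≤ _ := intervalIntegral.integral_mono_on_of_le_Ioo hR.le
        ((by fun_prop : Continuous _).intervalIntegrable _ _)
        ((by fun_prop : Continuous _).intervalIntegrable _ _) hpt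

/-! ### Integrals over discs in polar coordinates -/

/-- The open disc of radius `R` about the origin of the plane. -/
def disc (R : ℝ) : Set Plane := {a | a.1 ^ 2 + a.2 ^ 2 < R ^ 2}

lemma isOpen_disc (R : ℝ) : IsOpen (disc R) := isOpen_lt (by fun_prop) (by fun_prop)

lemma measurableSet_disc (R : ℝ) : MeasurableSet (disc R) := (isOpen_disc R).measurableSet

lemma disc_subset {R : ℝ} (hR : 0 ≤ R) : disc R ⊆ Set.Icc (-R) R ×ˢ Set.Icc (-R) R := by
  intro a ha
  have ha' : a.1 ^ 2 + a.2 ^ 2 < R ^ 2 := ha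
  have h1 := abs_le_of_sq_le_sq' (by nlinarith [sq_nonneg a.2] : a.1 ^ 2 ≤ R ^ 2) hR
  have h2 := abs_le_of_sq_le_sq' (by nlinarith [sq_nonneg a.1] : a.2 ^ 2 ≤ R ^ 2) hR
  exact ⟨h1, h2⟩

lemma setIntegral_disc {R : ℝ} (hR : 0 ≤ R) (G : Plane → ℝ) :
    ∫ a in disc R, G a = ∫ p in Set.Ioo (0 : ℝ) R ×ˢ Set.Ioo (-Real.pi) Real.pi,
      p.1 * G (p.1 * Real.cos p.2, p.1 * Real.sin p.2) := by
  rw [← integral_indicator (measurableSet_disc R), ← integral_comp_polarCoord_symm,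
    ← integral_indicator polarCoord.open_target.measurableSet,
    ← integral_indicator (measurableSet_Ioo.prod measurableSet_Ioo)]
  congr 1
  ext p
  have hmem : (p.1 * Real.cos p.2, p.1 * Real.sin p.2) ∈ disc R ↔ p.1 ^ 2 < R ^ 2 := by
    have : (p.1 * Real.cos p.2) ^ 2 + (p.1 * Real.sin p.2) ^ 2 = p.1 ^ 2 := by
      linear_combination p.1 ^ 2 * Real.sin_sq_add_cos_sq p.2
    simp only [disc, Set.mem_ofPred_eq, this]
  by_cases h1 : 0 < p.1 ∧ p.2 ∈ Set.Ioo (-Real.pi) Real.pi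
  · have ht : p ∈ polarCoord.target := h1
    rw [Set.indicator_of_mem ht, polarCoord_symm_apply]
    by_cases h2 : p.1 < R
    · rw [Set.indicator_of_mem (hmem.2 (pow_lt_pow_left₀ h2 h1.1.le two_ne_zero)),
        Set.indicator_of_mem (show p ∈ Set.Ioo (0 : ℝ) R ×ˢ _ from ⟨⟨h1.1, h2⟩, h1.2⟩), smul_eq_mul]
    · rw [Set.indicator_of_notMem, Set.indicator_of_notMem, smul_zero]
      · exact fun h => h2 h.1.2
      · exact fun h => h2 (lt_of_pow_lt_pow_left₀ 2 hR (hmem.1 h))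
  · rw [Set.indicator_of_notMem (show p ∉ polarCoord.target from h1), Set.indicator_of_notMem]
    exact fun h => h1 ⟨h.1.1, h.2⟩

lemma setIntegral_disc_radial {R : ℝ} (hR : 0 ≤ R) (g : ℝ → ℝ) :
    ∫ a in disc R, g (a.1 ^ 2 + a.2 ^ 2) = 2 * Real.pi * ∫ s in (0 : ℝ)..R, s * g (s ^ 2) := by
  rw [setIntegral_disc hR]
  have h : ∀ p : ℝ × ℝ, p.1 * g ((p.1 * Real.cos p.2) ^ 2 + (p.1 * Real.sin p.2) ^ 2)
      = (p.1 * g (p.1 ^ 2)) * 1 := fun p => by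
    have : (p.1 * Real.cos p.2) ^ 2 + (p.1 * Real.sin p.2) ^ 2 = p.1 ^ 2 := by
      linear_combination p.1 ^ 2 * Real.sin_sq_add_cos_sq p.2
    rw [this, mul_one]
  simp_rw [h]
  rw [Measure.volume_eq_prod, setIntegral_prod_mul (fun s : ℝ => s * g (s ^ 2)) (fun _ => (1 : ℝ)),
    intervalIntegral.integral_of_le hR, integral_Ioc_eq_integral_Ioo]
  have : ∫ _ in Set.Ioo (-Real.pi) Real.pi, (1 : ℝ) = 2 * Real.pi := by
    simp [Real.pi_pos.le, two_mul]
  rw [this, mul_comm]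

lemma volume_real_disc {R : ℝ} (hR : 0 ≤ R) : volume.real (disc R) = Real.pi * R ^ 2 := by
  have h := setIntegral_disc_radial hR (fun _ => 1)
  simp only [mul_one, integral_id, setIntegral_const, smul_eq_mul] at h
  rw [h]
  ring

lemma setIntegral_Ioo_prod_Ioo {H : ℝ × ℝ → ℝ} (hH : Continuous H) {a b c d : ℝ} (hab : a ≤ b)
    (hcd : c ≤ d) :
    ∫ p in Set.Ioo a b ×ˢ Set.Ioo c d, H p = ∫ s in a..b, ∫ t in c..d, H (s, t) := by
  rw [Measure.volume_eq_prod, setIntegral_prod]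
  · rw [intervalIntegral.integral_of_le hab, integral_Ioc_eq_integral_Ioo]
    congr 1
    ext s
    rw [intervalIntegral.integral_of_le hcd, integral_Ioc_eq_integral_Ioo]
  · exact (hH.continuousOn.integrableOn_compact (isCompact_Icc.prod isCompact_Icc)).mono_set
      (Set.prod_mono Set.Ioo_subset_Icc_self Set.Ioo_subset_Icc_self)

lemma integral_integral_swap_of_continuous {H : ℝ × ℝ → ℝ} (hH : Continuous H) {a b c d : ℝ}
    (hab : a ≤ b) (hcd : c ≤ d) :
    ∫ s in a..b, ∫ t in c..d, H (s, t) = ∫ t in c..d, ∫ s in a..b, H (s, t) := by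
  have h := setIntegral_Ioo_prod_Ioo (H := fun p => H p.swap) (by fun_prop) hcd hab
  simp only [Prod.swap_prod_mk] at h
  rw [← setIntegral_Ioo_prod_Ioo hH hab hcd, ← h, Measure.volume_eq_prod, ← setIntegral_prod_swap]

/-! ### The planar magnetic momentum and the Hardy inequality on a disc -/

/-- A quotient is continuous when the numerator vanishes wherever the denominator is small. -/
lemma continuous_div_mul_of_vanishing {X : Type*} [TopologicalSpace X] {k d : X → ℝ} {f : X → ℂ}
    (hk : Continuous k) (hd : Continuous d) (hf : Continuous f) {η : ℝ} (hη : 0 < η)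
    (h0 : ∀ x, d x < η → f x = 0) :
    Continuous fun x => ((k x / d x : ℝ) : ℂ) * f x := by
  have h : (fun x => ((k x / d x : ℝ) : ℂ) * f x)
      = fun x => ((k x / max (d x) η : ℝ) : ℂ) * f x := by
    ext x
    rcases lt_or_ge (d x) η with h | h
    · simp [h0 x h]
    · rw [max_eq_left h]
  rw [h]
  refine (Complex.continuous_ofReal.comp (hk.div (hd.max continuous_const) fun x => ?_)).mul hf
  exact (lt_of_lt_of_le hη (le_max_right _ _)).ne'

/-- The `c`-th component of `(-i ∇ + α (𝐚 - 𝐛)^{-⊥}) f`. -/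
def relMomentum (α : ℝ) (b : Plane) (c : Fin 2) (f : Plane → ℂ) (a : Plane) : ℂ :=
  -Complex.I * fderiv ℝ f a (unitVec c) + ((α * component c (perpInv (a - b)) : ℝ) : ℂ) * f a

lemma relMomentum_zero_index (α : ℝ) (b : Plane) (f : Plane → ℂ) (a : Plane) :
    relMomentum α b 0 f a = -Complex.I * fderiv ℝ f a (1, 0)
      + ((α * -(a.2 - b.2) / ((a.1 - b.1) ^ 2 + (a.2 - b.2) ^ 2) : ℝ) : ℂ) * f a := by
  simp [relMomentum, unitVec, component, perpInv, mul_div_assoc]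

lemma relMomentum_one_index (α : ℝ) (b : Plane) (f : Plane → ℂ) (a : Plane) :
    relMomentum α b 1 f a = -Complex.I * fderiv ℝ f a (0, 1)
      + ((α * (a.1 - b.1) / ((a.1 - b.1) ^ 2 + (a.2 - b.2) ^ 2) : ℝ) : ℂ) * f a := by
  simp [relMomentum, unitVec, component, perpInv, mul_div_assoc]

lemma continuous_relMomentum {f : Plane → ℂ} (hf : ContDiff ℝ 1 f) {b : Plane} {η : ℝ}
    (hη : 0 < η) (h0 : ∀ a : Plane, (a.1 - b.1) ^ 2 + (a.2 - b.2) ^ 2 < η → f a = 0)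
    (α : ℝ) (c : Fin 2) : Continuous (relMomentum α b c f) := by
  have hd : Continuous (fderiv ℝ f) := hf.continuous_fderiv one_ne_zero
  have hfc := hf.continuous
  fin_cases c
  · change Continuous (relMomentum α b 0 f)
    rw [funext (relMomentum_zero_index α b f)]
    exact Continuous.add (by fun_prop) (continuous_div_mul_of_vanishing
      (d := fun a : Plane => (a.1 - b.1) ^ 2 + (a.2 - b.2) ^ 2)
      (by fun_prop) (by fun_prop) hfc hη h0)
  · change Continuous (relMomentum α b 1 f)
    rw [funext (relMomentum_one_index α b f)]
    exact Continuous.add (by fun_prop) (continuous_div_mul_of_vanishing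
      (d := fun a : Plane => (a.1 - b.1) ^ 2 + (a.2 - b.2) ^ 2)
      (by fun_prop) (by fun_prop) hfc hη h0)

lemma sq_norm_add_sq_norm_rotate (A B : ℂ) {c s : ℝ} (h : s ^ 2 + c ^ 2 = 1) :
    ‖A‖ ^ 2 + ‖B‖ ^ 2 = ‖(c : ℂ) * A + (s : ℂ) * B‖ ^ 2 + ‖-(s : ℂ) * A + (c : ℂ) * B‖ ^ 2 := by
  simp only [Complex.sq_norm, Complex.normSq_apply, Complex.mul_re, Complex.mul_im, Complex.add_re,
    Complex.add_im, Complex.neg_re, Complex.neg_im, Complex.ofReal_re, Complex.ofReal_im]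
  linear_combination -(A.re ^ 2 + A.im ^ 2 + B.re ^ 2 + B.im ^ 2) * h

lemma fderiv_plane_apply (f : Plane → ℂ) (a : Plane) (x y : ℝ) :
    fderiv ℝ f a (x, y) = (x : ℂ) * fderiv ℝ f a (1, 0) + (y : ℂ) * fderiv ℝ f a (0, 1) := by
  have : ((x, y) : Plane) = x • ((1, 0) : Plane) + y • ((0, 1) : Plane) := by simp
  rw [this, map_add, map_smul, map_smul, Complex.real_smul, Complex.real_smul]

/-- The kinetic energy density in polar coordinates. -/
lemma sum_sq_relMomentum_polar (f : Plane → ℂ) (α : ℝ) {r : ℝ} (hr : r ≠ 0) (θ : ℝ) :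
    ∑ c, ‖relMomentum α 0 c f (r * Real.cos θ, r * Real.sin θ)‖ ^ 2
      = ‖fderiv ℝ f (r * Real.cos θ, r * Real.sin θ) (Real.cos θ, Real.sin θ)‖ ^ 2
        + ‖-Complex.I * fderiv ℝ f (r * Real.cos θ, r * Real.sin θ)
              (-(r * Real.sin θ), r * Real.cos θ)
            + (α : ℂ) * f (r * Real.cos θ, r * Real.sin θ)‖ ^ 2 / r ^ 2 := by
  set a : Plane := (r * Real.cos θ, r * Real.sin θ) with ha
  have hsc := Real.sin_sq_add_cos_sq θ
  have hden : (a.1 - (0 : Plane).1) ^ 2 + (a.2 - (0 : Plane).2) ^ 2 = r ^ 2 := by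
    simp only [ha, Prod.fst_zero, Prod.snd_zero, sub_zero]
    linear_combination r ^ 2 * hsc
  rw [Fin.sum_univ_two, relMomentum_zero_index, relMomentum_one_index, hden,
    sq_norm_add_sq_norm_rotate _ _ hsc, fderiv_plane_apply f a (Real.cos θ),
    fderiv_plane_apply f a (-(r * Real.sin θ))]
  have hsc' : (Real.sin θ : ℂ) ^ 2 + (Real.cos θ : ℂ) ^ 2 = 1 := by exact_mod_cast hsc
  have hr' : (r : ℂ) ≠ 0 := by exact_mod_cast hr
  set px := fderiv ℝ f a (1, 0)
  set py := fderiv ℝ f a (0, 1)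
  simp only [Prod.fst_zero, Prod.snd_zero, sub_zero]
  congr 1
  · have : ‖(Real.cos θ : ℂ) * px + (Real.sin θ : ℂ) * py‖
        = ‖-Complex.I * ((Real.cos θ : ℂ) * px + (Real.sin θ : ℂ) * py)‖ := by simp
    rw [this]
    congr 2
    simp only [ha]
    push_cast
    field_simp
    ring
  · have hdiv : ∀ z : ℂ, ‖z‖ ^ 2 / r ^ 2 = ‖z / (r : ℂ)‖ ^ 2 := fun z => by
      rw [norm_div, Complex.norm_real, Real.norm_eq_abs, div_pow, sq_abs]
    rw [hdiv]
    congr 2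
    simp only [ha]
    push_cast
    field_simp
    push_cast at hsc'
    linear_combination (α : ℂ) * f a * hsc'

/-- The magnetic Hardy inequality on a disc, with the potential spread over the disc. -/
lemma hardy_disc {f : Plane → ℂ} (hf : ContDiff ℝ 1 f) {δ : ℝ} (hδ : 0 < δ)
    (h0 : ∀ a : Plane, a.1 ^ 2 + a.2 ^ 2 < δ ^ 2 → f a = 0) {α R : ℝ} (hα : 0 ≤ α)
    (hα' : α * (4 * Real.pi) ≤ 1) (hR : 0 < R) :
    2 * α / R ^ 2 * ∫ a in disc R, ‖f a‖ ^ 2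
      ≤ ∫ a in disc R, ∑ c, ‖relMomentum α 0 c f a‖ ^ 2 := by
  have hπ : -Real.pi ≤ Real.pi := by linarith [Real.pi_pos]
  have hfc := hf.continuous
  have hd : Continuous (fderiv ℝ f) := hf.continuous_fderiv one_ne_zero
  have hm : ∀ c, Continuous (relMomentum α 0 c f) := fun c =>
    continuous_relMomentum hf (pow_pos hδ 2) (fun a ha => h0 a (by simpa using ha)) α c
  set P : ℝ × ℝ → Plane := fun p => (p.1 * Real.cos p.2, p.1 * Real.sin p.2) with hP
  have hPc : Continuous P := by fun_prop
  have hvan : ∀ p : ℝ × ℝ, |p.1| < δ → f (P p) = 0 := fun p hp => by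
    refine h0 _ ?_
    have : (P p).1 ^ 2 + (P p).2 ^ 2 = p.1 ^ 2 := by
      simp only [hP]
      linear_combination p.1 ^ 2 * Real.sin_sq_add_cos_sq p.2
    rw [this]
    exact sq_lt_sq' (abs_lt.1 hp).1 (abs_lt.1 hp).2
  set Fr : ℝ × ℝ → ℂ := fun p => fderiv ℝ f (P p) (Real.cos p.2, Real.sin p.2) with hFr
  set Ft : ℝ × ℝ → ℂ := fun p => fderiv ℝ f (P p) (-(p.1 * Real.sin p.2), p.1 * Real.cos p.2)
    with hFt
  have hFrc : Continuous Fr := (hd.comp hPc).clm_apply (by fun_prop)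
  have hFtc : Continuous Ft := (hd.comp hPc).clm_apply (by fun_prop)
  have hfP : Continuous fun p => f (P p) := hfc.comp hPc
  have hder_r : ∀ r θ, HasDerivAt (fun r => f (P (r, θ))) (Fr (r, θ)) r := fun r θ => by
    have h1 : HasDerivAt (fun r : ℝ => P (r, θ)) (Real.cos θ, Real.sin θ) r := by
      refine HasDerivAt.prodMk ?_ ?_
      · simpa using (hasDerivAt_id r).mul_const (Real.cos θ)
      · simpa using (hasDerivAt_id r).mul_const (Real.sin θ)
    exact ((hf.differentiable one_ne_zero) (P (r, θ))).hasFDerivAt.comp_hasDerivAt r h1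
  have hder_t : ∀ r θ, HasDerivAt (fun θ => f (P (r, θ))) (Ft (r, θ)) θ := fun r θ => by
    have h1 : HasDerivAt (fun θ : ℝ => P (r, θ)) (-(r * Real.sin θ), r * Real.cos θ) θ := by
      refine HasDerivAt.prodMk ?_ ?_
      · simpa using (Real.hasDerivAt_cos θ).const_mul r
      · simpa using (Real.hasDerivAt_sin θ).const_mul r
    exact ((hf.differentiable one_ne_zero) (P (r, θ))).hasFDerivAt.comp_hasDerivAt θ h1
  have hquot : Continuous fun p : ℝ × ℝ => ‖f (P p)‖ ^ 2 / p.1 := by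
    -- The denominator `p.1` is negative on a half-plane where `f` need not vanish, so the quotient
    -- is rewritten with denominator `p.1 ^ 2`.
    have h1 := continuous_div_mul_of_vanishing (k := fun p : ℝ × ℝ => p.1 * ‖f (P p)‖)
      (d := fun p : ℝ × ℝ => p.1 ^ 2) (f := fun p => (‖f (P p)‖ : ℂ)) (by fun_prop) (by fun_prop)
      (by fun_prop) (pow_pos hδ 2) (fun p hp => by
        rw [hvan p (abs_lt_of_sq_lt_sq hp hδ.le)]; simp)
    refine (Complex.continuous_re.comp h1).congr fun p => ?_
    simp only [Function.comp_apply, ← Complex.ofReal_mul, Complex.ofReal_re]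
    rcases eq_or_ne p.1 0 with h | h
    · simp [h]
    · field_simp
  set H : ℝ × ℝ → ℝ := fun p => p.1 * ‖Fr p‖ ^ 2 + α ^ 2 * (‖f (P p)‖ ^ 2 / p.1) with hH
  have hHc : Continuous H := by fun_prop
  have hG : Continuous fun p : ℝ × ℝ => p.1 * ∑ c, ‖relMomentum α 0 c f (P p)‖ ^ 2 := by
    have : ∀ c, Continuous fun p => relMomentum α 0 c f (P p) := fun c => (hm c).comp hPc
    fun_prop
  calc 2 * α / R ^ 2 * ∫ a in disc R, ‖f a‖ ^ 2
      = 2 * α / R ^ 2 * ∫ r in (0 : ℝ)..R, ∫ θ in -Real.pi..Real.pi, r * ‖f (P (r, θ))‖ ^ 2 := by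
        rw [setIntegral_disc hR.le, setIntegral_Ioo_prod_Ioo (by fun_prop) hR.le hπ]
    _ = ∫ θ in -Real.pi..Real.pi, 2 * α / R ^ 2 * ∫ r in (0 : ℝ)..R, r * ‖f (P (r, θ))‖ ^ 2 := by
        rw [integral_integral_swap_of_continuous (H := fun p => p.1 * ‖f (P p)‖ ^ 2) (by fun_prop)
          hR.le hπ, intervalIntegral.integral_const_mul]
    _ ≤ ∫ θ in -Real.pi..Real.pi, ∫ r in (0 : ℝ)..R, H (r, θ) := by
        refine intervalIntegral.integral_mono_on hπ ?_ ?_ fun θ _ => ?_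
        · refine Continuous.intervalIntegrable (continuous_const.mul ?_) _ _
          exact intervalIntegral.continuous_parametric_intervalIntegral_of_continuous'
            (f := fun θ r => r * ‖f (P (r, θ))‖ ^ 2) (by fun_prop) 0 R
        · refine Continuous.intervalIntegrable ?_ _ _
          exact intervalIntegral.continuous_parametric_intervalIntegral_of_continuous'
            (f := fun θ r => H (r, θ)) (by fun_prop) 0 R
        · exact radial_lower_bound (fun r => hder_r r θ) (by fun_prop)
            (hvan _ (by simpa using hδ)) hα hR (hquot.comp (by fun_prop : Continuous fun r => (r, θ)))
    _ = ∫ r in (0 : ℝ)..R, ∫ θ in -Real.pi..Real.pi, H (r, θ) :=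
        (integral_integral_swap_of_continuous hHc hR.le hπ).symm
    _ ≤ ∫ r in (0 : ℝ)..R, ∫ θ in -Real.pi..Real.pi,
          r * ∑ c, ‖relMomentum α 0 c f (P (r, θ))‖ ^ 2 := by
        refine intervalIntegral.integral_mono_on_of_le_Ioo hR.le ?_ ?_ fun r hr => ?_
        · refine Continuous.intervalIntegrable ?_ _ _
          exact intervalIntegral.continuous_parametric_intervalIntegral_of_continuous'
            (f := fun r θ => H (r, θ)) (by fun_prop) _ _
        · refine Continuous.intervalIntegrable ?_ _ _
          exact intervalIntegral.continuous_parametric_intervalIntegral_of_continuous'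
            (f := fun r θ => r * ∑ c, ‖relMomentum α 0 c f (P (r, θ))‖ ^ 2) hG _ _
        · have hr0 := hr.1.ne'
          have h1 : ∀ θ, r * ∑ c, ‖relMomentum α 0 c f (P (r, θ))‖ ^ 2
              = r * ‖Fr (r, θ)‖ ^ 2
                + r⁻¹ * ‖-Complex.I * Ft (r, θ) + (α : ℂ) * f (P (r, θ))‖ ^ 2 := fun θ => by
            rw [sum_sq_relMomentum_polar f α hr0 θ]
            field_simp
            rfl
          have h2 : ∀ θ, H (r, θ) = r * ‖Fr (r, θ)‖ ^ 2
              + r⁻¹ * (α ^ 2 * ‖f (P (r, θ))‖ ^ 2) := fun θ => by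
            simp only [hH]
            field_simp
          simp_rw [h1, h2]
          rw [intervalIntegral.integral_add, intervalIntegral.integral_add,
            intervalIntegral.integral_const_mul r⁻¹, intervalIntegral.integral_const_mul r⁻¹,
            intervalIntegral.integral_const_mul (α ^ 2)]
          · gcongr
            · exact inv_nonneg.2 hr.1.le
            · exact angular_lower_bound (fun θ => hder_t r θ) (by fun_prop) (by simp [hP]) hα hα'
          all_goals exact (by fun_prop : Continuous _).intervalIntegrable _ _
    _ = ∫ a in disc R, ∑ c, ‖relMomentum α 0 c f a‖ ^ 2 := by
        rw [setIntegral_disc hR.le, setIntegral_Ioo_prod_Ioo hG hR.le hπ]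

/-! ### Comparison of means over the unit square -/

lemma isCompact_unitSquare : IsCompact unitSquare := isCompact_Icc.prod isCompact_Icc

lemma measurableSet_unitSquare : MeasurableSet unitSquare := isCompact_unitSquare.measurableSet

lemma setIntegral_unitSquare {H : Plane → ℝ} (hH : Continuous H) :
    ∫ p in unitSquare, H p = ∫ s in (0 : ℝ)..1, ∫ t in (0 : ℝ)..1, H (s, t) := by
  rw [unitSquare, Measure.volume_eq_prod, setIntegral_prod]
  · rw [intervalIntegral.integral_of_le zero_le_one, integral_Icc_eq_integral_Ioc]
    congr 1
    ext s
    rw [intervalIntegral.integral_of_le zero_le_one, integral_Icc_eq_integral_Ioc]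
  · exact hH.continuousOn.integrableOn_compact isCompact_unitSquare

lemma setIntegral_unitSquare_const (k : ℝ) : ∫ _ in unitSquare, k = k := by
  rw [setIntegral_unitSquare continuous_const]
  simp

lemma setIntegral_unitSquare_symm {H : Plane → ℝ} (hH : Continuous H) :
    ∫ p in unitSquare, H p = ∫ t in (0 : ℝ)..1, ∫ s in (0 : ℝ)..1, H (s, t) := by
  rw [setIntegral_unitSquare hH,
    integral_integral_swap_of_continuous hH zero_le_one zero_le_one]

/-- Comparison of the mean of `u²` over the unit square with its mean over a subset `T`, in terms
of bounds on the oscillation of `u` along horizontal and vertical lines. -/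
lemma mean_sq_unitSquare_le {u Gx Gy : Plane → ℝ} (hu : Continuous u) (hGx : Continuous Gx)
    (hGy : Continuous Gy) (hGx0 : ∀ p, 0 ≤ Gx p)
    (hx : ∀ y, ∀ s ∈ Set.Icc (0 : ℝ) 1, ∀ t ∈ Set.Icc (0 : ℝ) 1,
      (u (s, y) - u (t, y)) ^ 2 ≤ ∫ r in (0 : ℝ)..1, Gx (r, y))
    (hy : ∀ x, ∀ s ∈ Set.Icc (0 : ℝ) 1, ∀ t ∈ Set.Icc (0 : ℝ) 1,
      (u (x, s) - u (x, t)) ^ 2 ≤ ∫ r in (0 : ℝ)..1, Gy (x, r))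
    {T : Set Plane} (hT : MeasurableSet T) (hTQ : T ⊆ unitSquare) {l w : ℝ} (hw : 0 ≤ w)
    (hTw : T ⊆ Set.Icc l (l + w) ×ˢ Set.Icc (0 : ℝ) 1) {δ : ℝ} (hδ : 0 < δ) :
    volume.real T * ∫ q in unitSquare, u q ^ 2
      ≤ (1 + δ) * (∫ p in T, u p ^ 2)
        + (1 + δ⁻¹) * (2 * (w * (∫ q in unitSquare, Gx q)
          + volume.real T * ∫ q in unitSquare, Gy q)) := by
  set m := volume.real T with hm
  set gx : ℝ → ℝ := fun y => ∫ r in (0 : ℝ)..1, Gx (r, y) with hgx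
  set gy : ℝ → ℝ := fun x => ∫ r in (0 : ℝ)..1, Gy (x, r) with hgy
  have hgxc : Continuous gx :=
    intervalIntegral.continuous_parametric_intervalIntegral_of_continuous'
      (f := fun y r => Gx (r, y)) (by fun_prop) 0 1
  have hgyc : Continuous gy :=
    intervalIntegral.continuous_parametric_intervalIntegral_of_continuous'
      (f := fun x r => Gy (x, r)) (by fun_prop) 0 1
  have hgx0 : ∀ y, 0 ≤ gx y := fun y =>
    intervalIntegral.integral_nonneg zero_le_one fun r _ => hGx0 _
  have hIQ : ∀ {h : Plane → ℝ}, Continuous h → IntegrableOn h unitSquare := fun hh =>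
    hh.continuousOn.integrableOn_compact isCompact_unitSquare
  have hIT : ∀ {h : Plane → ℝ}, Continuous h → IntegrableOn h T := fun hh => (hIQ hh).mono_set hTQ
  have hgyQ : ∫ q in unitSquare, gy q.1 = ∫ q in unitSquare, Gy q := by
    rw [setIntegral_unitSquare hGy, setIntegral_unitSquare (by fun_prop)]
    simp [hgy]
  -- Since `gx` depends on the height only, its integral over `T` costs the width `w` of `T`. For a
  -- disc this gives `w / |T|` of order `1/R`, which fixes the final rate.
  have hgxT : ∫ p in T, gx p.2 ≤ w * ∫ q in unitSquare, Gx q := by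
    have h1 : ∫ p in T, gx p.2 ≤ ∫ p in Set.Icc l (l + w) ×ˢ Set.Icc (0 : ℝ) 1, gx p.2 :=
      setIntegral_mono_set
        ((by fun_prop : Continuous _).continuousOn.integrableOn_compact
          (isCompact_Icc.prod isCompact_Icc))
        (Eventually.of_forall fun p => hgx0 _) hTw.eventuallyLE
    have h2 : ∫ p in Set.Icc l (l + w) ×ˢ Set.Icc (0 : ℝ) 1, gx p.2
        = w * ∫ y in (0 : ℝ)..1, gx y := by
      have := setIntegral_prod_mul (μ := (volume : Measure ℝ)) (ν := (volume : Measure ℝ))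
        (fun _ => (1 : ℝ)) gx (Set.Icc l (l + w)) (Set.Icc (0 : ℝ) 1)
      simp only [one_mul] at this
      rw [Measure.volume_eq_prod, this, intervalIntegral.integral_of_le zero_le_one,
        integral_Icc_eq_integral_Ioc (f := gx)]
      simp [hw]
    rw [setIntegral_unitSquare_symm hGx, ← h2]
    exact h1
  have hδ' : 0 < δ⁻¹ := inv_pos.2 hδ
  have hpt : ∀ q ∈ unitSquare, ∀ p ∈ T,
      u q ^ 2 ≤ (1 + δ) * u p ^ 2 + (1 + δ⁻¹) * (2 * (gx p.2 + gy q.1)) := fun q hq p hp => by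
    have hp' := hTQ hp
    -- The path from `p` to `q` turns at `(q.1, p.2)`: its horizontal leg is governed by `p.2` alone
    -- and its vertical leg by `q.1` alone.
    have h1 : (u (p.1, p.2) - u (q.1, p.2)) ^ 2 ≤ gx p.2 := hx p.2 _ hp'.1 _ hq.1
    have h2 : (u (q.1, p.2) - u (q.1, q.2)) ^ 2 ≤ gy q.1 := hy q.1 _ hp'.2 _ hq.2
    rw [Prod.mk.eta] at h1 h2
    have h3 : (u p - u q) ^ 2 ≤ 2 * (gx p.2 + gy q.1) := by
      nlinarith [sq_nonneg ((u p - u (q.1, p.2)) - (u (q.1, p.2) - u q))]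
    have h4 : u q ^ 2 ≤ (1 + δ) * u p ^ 2 + (1 + δ⁻¹) * (u p - u q) ^ 2 := by
      have h5 : (1 + δ) * u p ^ 2 + (1 + δ⁻¹) * (u p - u q) ^ 2 - u q ^ 2
          = δ⁻¹ * (δ * u p + (u p - u q)) ^ 2 := by
        field_simp
        ring
      have h6 : 0 ≤ δ⁻¹ * (δ * u p + (u p - u q)) ^ 2 := by positivity
      linarith
    nlinarith
  have hq : ∀ q ∈ unitSquare, m * u q ^ 2
      ≤ ((1 + δ) * (∫ p in T, u p ^ 2) + (1 + δ⁻¹) * (2 * (w * ∫ q in unitSquare, Gx q)))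
        + (1 + δ⁻¹) * (2 * m) * gy q.1 := fun q hq => by
    have h1 : ∫ p in T, u q ^ 2
        ≤ ∫ p in T, ((1 + δ) * u p ^ 2 + (1 + δ⁻¹) * (2 * (gx p.2 + gy q.1))) :=
      setIntegral_mono_on (hIT continuous_const) (hIT (by fun_prop)) hT (hpt q hq)
    rw [setIntegral_const, smul_eq_mul, ← hm, integral_add (hIT (by fun_prop)) (hIT (by fun_prop)),
      integral_const_mul, integral_const_mul, integral_const_mul,
      integral_add (hIT (by fun_prop)) (hIT continuous_const), setIntegral_const, smul_eq_mul,
      ← hm] at h1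
    have h2 : (1 + δ⁻¹) * (2 * (∫ p in T, gx p.2)) ≤ (1 + δ⁻¹) * (2 * (w * ∫ q in unitSquare, Gx q)) := by
      gcongr
    linarith
  have h := setIntegral_mono_on (hIQ (by fun_prop)) (hIQ (by fun_prop)) measurableSet_unitSquare hq
  rw [integral_const_mul, integral_add (hIQ continuous_const) (hIQ (by fun_prop)),
    integral_const_mul, hgyQ] at h
  rw [setIntegral_unitSquare_const] at h
  linarith

/-! ### One particle with the other held fixed -/

/-- The magnetic kinetic energy density in the plane, with the flux placed at `b`. -/
def relDensity (α : ℝ) (b : Plane) (f : Plane → ℂ) (a : Plane) : ℝ :=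
  ∑ c, ‖relMomentum α b c f a‖ ^ 2

lemma relDensity_nonneg (α : ℝ) (b : Plane) (f : Plane → ℂ) (a : Plane) :
    0 ≤ relDensity α b f a := Finset.sum_nonneg fun _ _ => sq_nonneg _

lemma setIntegral_disc_translate (b : Plane) (R : ℝ) (g : Plane → ℝ) :
    ∫ a in (fun a => a - b) ⁻¹' disc R, g a = ∫ a in disc R, g (a + b) := by
  rw [← (measurePreserving_sub_right volume b).setIntegral_preimage_emb
    (MeasurableEquiv.subRight b).measurableEmbedding (fun a => g (a + b)) (disc R)]
  simp

section Slice

variable {f : Plane → ℂ} {b : Plane} {η : ℝ}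

lemma continuous_relDensity (hf : ContDiff ℝ 1 f) (hη : 0 < η)
    (h0 : ∀ a : Plane, (a.1 - b.1) ^ 2 + (a.2 - b.2) ^ 2 < η → f a = 0) (α : ℝ) :
    Continuous (relDensity α b f) := by
  have h := continuous_relMomentum hf hη h0 α
  unfold relDensity
  fun_prop

/-- The diamagnetic bound along lines supplies the oscillation hypotheses for `‖f‖`. Since `|T| ≤
w`, both directional energies may carry the factor `w` and combine into the full density. -/
lemma magnetic_mean_sq_le (hf : ContDiff ℝ 1 f) (hη : 0 < η)
    (h0 : ∀ a : Plane, (a.1 - b.1) ^ 2 + (a.2 - b.2) ^ 2 < η → f a = 0) (α : ℝ)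
    {T : Set Plane} (hT : MeasurableSet T) (hTQ : T ⊆ unitSquare) {l w : ℝ} (hw : 0 ≤ w)
    (hTw : T ⊆ Set.Icc l (l + w) ×ˢ Set.Icc (0 : ℝ) 1) (hmw : volume.real T ≤ w)
    {δ : ℝ} (hδ : 0 < δ) :
    volume.real T * ∫ q in unitSquare, ‖f q‖ ^ 2
      ≤ (1 + δ) * (∫ p in T, ‖f p‖ ^ 2)
        + (1 + δ⁻¹) * (2 * (w * ∫ q in unitSquare, relDensity α b f q)) := by
  have hm := continuous_relMomentum hf hη h0 α
  have hd : Continuous (fderiv ℝ f) := hf.continuous_fderiv one_ne_zero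
  have hfc := hf.continuous
  have hIQ : ∀ c, IntegrableOn (fun q => ‖relMomentum α b c f q‖ ^ 2) unitSquare := fun c =>
    ((hm c).norm.pow 2).continuousOn.integrableOn_compact isCompact_unitSquare
  have h := mean_sq_unitSquare_le (u := fun p => ‖f p‖)
    (Gx := fun p => ‖relMomentum α b 0 f p‖ ^ 2) (Gy := fun p => ‖relMomentum α b 1 f p‖ ^ 2)
    hfc.norm ((hm 0).norm.pow 2) ((hm 1).norm.pow 2) (fun p => sq_nonneg _)
    (fun y s hs t ht => ?_) (fun x s hs t ht => ?_) hT hTQ hw hTw hδ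
  · refine h.trans ?_
    have h1 : ∫ q in unitSquare, relDensity α b f q
        = (∫ q in unitSquare, ‖relMomentum α b 0 f q‖ ^ 2)
          + ∫ q in unitSquare, ‖relMomentum α b 1 f q‖ ^ 2 := by
      rw [← integral_add (hIQ 0) (hIQ 1)]
      simp only [relDensity, Fin.sum_univ_two]
    have h2 : 0 ≤ ∫ q in unitSquare, ‖relMomentum α b 1 f q‖ ^ 2 :=
      integral_nonneg fun q => sq_nonneg _
    have hδ' : 0 < δ⁻¹ := inv_pos.2 hδ
    rw [h1, mul_add w]
    gcongr
  · refine sq_norm_sub_norm_le (F := fun r => f (r, y)) (F' := fun r => fderiv ℝ f (r, y) (1, 0))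
      (A := fun r => α * component 0 (perpInv ((r, y) - b))) (fun r => ?_) (by fun_prop) ?_ ht hs
    · exact ((hf.differentiable one_ne_zero) (r, y)).hasFDerivAt.comp_hasDerivAt r
        ((hasDerivAt_id r).prodMk (hasDerivAt_const r y))
    · exact (hm 0).comp (by fun_prop : Continuous fun r : ℝ => (r, y))
  · refine sq_norm_sub_norm_le (F := fun r => f (x, r)) (F' := fun r => fderiv ℝ f (x, r) (0, 1))
      (A := fun r => α * component 1 (perpInv ((x, r) - b))) (fun r => ?_) (by fun_prop) ?_ ht hs
    · exact ((hf.differentiable one_ne_zero) (x, r)).hasFDerivAt.comp_hasDerivAt r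
        ((hasDerivAt_const r x).prodMk (hasDerivAt_id r))
    · exact (hm 1).comp (by fun_prop : Continuous fun r : ℝ => (x, r))

lemma hardy_disc_translate (hf : ContDiff ℝ 1 f) (hη : 0 < η)
    (h0 : ∀ a : Plane, (a.1 - b.1) ^ 2 + (a.2 - b.2) ^ 2 < η → f a = 0) {α R : ℝ}
    (hα : 0 ≤ α) (hα' : α * (4 * Real.pi) ≤ 1) (hR : 0 < R) :
    2 * α / R ^ 2 * ∫ a in (fun a => a - b) ⁻¹' disc R, ‖f a‖ ^ 2
      ≤ ∫ a in (fun a => a - b) ⁻¹' disc R, relDensity α b f a := by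
  rw [setIntegral_disc_translate, setIntegral_disc_translate]
  have h := hardy_disc (f := fun a => f (a + b)) (hf.comp (by fun_prop)) (δ := √η)
    (Real.sqrt_pos.2 hη) (fun a ha => h0 _ (by simpa [Real.sq_sqrt hη.le] using ha)) hα hα' hR
  refine h.trans_eq ?_
  congr 1
  ext a
  simp only [relDensity, relMomentum, fderiv_comp_add_right, sub_zero, add_sub_cancel_right]

lemma volume_real_disc_translate (b : Plane) {R : ℝ} (hR : 0 ≤ R) :
    volume.real ((fun a => a - b) ⁻¹' disc R) = Real.pi * R ^ 2 := by
  rw [measureReal_def, (measurePreserving_sub_right volume b).measure_preimage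
    (measurableSet_disc R).nullMeasurableSet, ← measureReal_def, volume_real_disc hR]

/-- Energy of one particle on the unit square, with the other fixed at distance at least `R` from
the boundary. -/
lemma sq_norm_le_relDensity (hf : ContDiff ℝ 1 f) (hη : 0 < η)
    (h0 : ∀ a : Plane, (a.1 - b.1) ^ 2 + (a.2 - b.2) ^ 2 < η → f a = 0) {α R δ : ℝ}
    (hα : 0 < α) (hα' : α * (4 * Real.pi) ≤ 1) (hR : 0 < R) (hR' : R ≤ 1 / 2)
    (hb : b ∈ Set.Icc R (1 - R) ×ˢ Set.Icc R (1 - R)) (hδ : 0 < δ) :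
    ∫ q in unitSquare, ‖f q‖ ^ 2
      ≤ ((1 + δ) / (2 * Real.pi * α) + (1 + δ⁻¹) * (4 / (Real.pi * R)))
        * ∫ q in unitSquare, relDensity α b f q := by
  have hpi := Real.pi_pos
  set T : Set Plane := (fun a => a - b) ⁻¹' disc R with hTdef
  have hT : MeasurableSet T := measurable_id.sub_const b (measurableSet_disc R)
  have hTsub : ∀ a ∈ T, a ∈ Set.Icc (b.1 - R) (b.1 - R + 2 * R)
      ×ˢ Set.Icc (b.2 - R) (b.2 + R) := fun a ha => by
    have h1 := disc_subset hR.le ha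
    obtain ⟨⟨h2, h3⟩, h4, h5⟩ := h1
    simp only [Prod.fst_sub, Prod.snd_sub] at h2 h3 h4 h5
    exact ⟨⟨by linarith, by linarith⟩, by linarith, by linarith⟩
  obtain ⟨⟨hb1, hb2⟩, hb3, hb4⟩ := hb
  have hTQ : T ⊆ unitSquare := fun a ha => by
    obtain ⟨⟨h2, h3⟩, h4, h5⟩ := hTsub a ha
    exact ⟨⟨by linarith, by linarith⟩, by linarith, by linarith⟩
  have hTw : T ⊆ Set.Icc (b.1 - R) (b.1 - R + 2 * R) ×ˢ Set.Icc (0 : ℝ) 1 := fun a ha =>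
    ⟨(hTsub a ha).1, (hTQ ha).2⟩
  have hvol : volume.real T = Real.pi * R ^ 2 := volume_real_disc_translate b hR.le
  have hdc := continuous_relDensity hf hη h0 α
  have hmain := magnetic_mean_sq_le hf hη h0 α hT hTQ (by positivity) hTw
    (by rw [hvol]; nlinarith [Real.pi_lt_four]) hδ
  have hhardy := hardy_disc_translate hf hη h0 hα.le hα' hR
  have hmono : ∫ a in T, relDensity α b f a ≤ ∫ a in unitSquare, relDensity α b f a :=
    setIntegral_mono_set (hdc.continuousOn.integrableOn_compact isCompact_unitSquare)
      (Eventually.of_forall fun a => relDensity_nonneg _ _ _ _) hTQ.eventuallyLE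
  set I := ∫ q in unitSquare, ‖f q‖ ^ 2
  set J := ∫ q in unitSquare, relDensity α b f q
  have h1 : ∫ a in T, ‖f a‖ ^ 2 ≤ R ^ 2 / (2 * α) * J := by
    have h2 : ∫ a in T, ‖f a‖ ^ 2
        = R ^ 2 / (2 * α) * (2 * α / R ^ 2 * ∫ a in T, ‖f a‖ ^ 2) := by
      field_simp
    rw [h2]
    gcongr
    exact hhardy.trans hmono
  rw [hvol] at hmain
  -- Here `w = 2R`. The factor `R ^ 2` of the Hardy bound cancels the area of the disc, leaving the
  -- leading constant `1 / (2πα)`.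
  have h3 : Real.pi * R ^ 2 * I ≤ Real.pi * R ^ 2
      * (((1 + δ) / (2 * Real.pi * α) + (1 + δ⁻¹) * (4 / (Real.pi * R))) * J) := by
    calc _ ≤ _ := hmain
      _ ≤ (1 + δ) * (R ^ 2 / (2 * α) * J) + (1 + δ⁻¹) * (2 * (2 * R * J)) := by gcongr
      _ = _ := by field_simp; ring
  exact le_of_mul_le_mul_left h3 (by positivity)

/-- Discs of radius `R` fit in the square only around centres in the inner square; this recovers the
mass lost by that restriction. It is applied with the particles exchanged, `f` being a function of
the former centre. -/
lemma sq_norm_le_inner_square (hf : ContDiff ℝ 1 f) (hη : 0 < η)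
    (h0 : ∀ a : Plane, (a.1 - b.1) ^ 2 + (a.2 - b.2) ^ 2 < η → f a = 0) (α : ℝ) {R δ : ℝ}
    (hR : 0 < R) (hR' : R ≤ 1 / 2) (hδ : 0 < δ) :
    (1 - 2 * R) ^ 2 * ∫ q in unitSquare, ‖f q‖ ^ 2
      ≤ (1 + δ) * (∫ p in Set.Icc R (1 - R) ×ˢ Set.Icc R (1 - R), ‖f p‖ ^ 2)
        + (1 + δ⁻¹) * (2 * ∫ q in unitSquare, relDensity α b f q) := by
  have hI : Set.Icc R (1 - R) ⊆ Set.Icc (0 : ℝ) 1 := Set.Icc_subset_Icc hR.le (by linarith)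
  have hvol : volume.real (Set.Icc R (1 - R) ×ˢ Set.Icc R (1 - R)) = (1 - 2 * R) ^ 2 := by
    rw [Measure.volume_eq_prod, measureReal_prod_prod, Real.volume_real_Icc_of_le (by linarith)]
    ring
  have h := magnetic_mean_sq_le hf hη h0 α (measurableSet_Icc.prod measurableSet_Icc)
    (T := Set.Icc R (1 - R) ×ˢ Set.Icc R (1 - R)) (Set.prod_mono hI hI) (l := 0) zero_le_one
    (by rw [zero_add]; exact Set.prod_mono hI hI) (by rw [hvol]; nlinarith) hδ
  rwa [hvol, one_mul] at h

end Slice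

/-! ### The two-particle lower bound for symmetric functions -/

lemma setIntegral_integral_swap {h : Plane × Plane → ℝ} (hh : Continuous h) {K L : Set Plane}
    (hK : IsCompact K) (hL : IsCompact L) :
    ∫ a in K, ∫ b in L, h (a, b) = ∫ b in L, ∫ a in K, h (a, b) := by
  refine integral_integral_swap (f := fun a b => h (a, b)) ?_
  rw [Measure.prod_restrict]
  exact hh.continuousOn.integrableOn_compact (hK.prod hL)

lemma integrableOn_setIntegral {h : Plane × Plane → ℝ} (hh : Continuous h) {K L : Set Plane}
    (hK : IsCompact K) (hL : IsCompact L) :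
    IntegrableOn (fun a => ∫ b in L, h (a, b)) K := by
  refine Integrable.integral_prod_left (f := h) ?_
  rw [Measure.prod_restrict]
  exact hh.continuousOn.integrableOn_compact (hK.prod hL)

/-- Combination of a bound for one particle, with the other in `S`, with a bound that extends
the position of the other particle to the whole square. -/
lemma setIntegral_setIntegral_le_of_slices {n e : Plane → Plane → ℝ}
    (hn : Continuous fun p : Plane × Plane => n p.1 p.2)
    (he : Continuous fun p : Plane × Plane => e p.1 p.2) (he0 : ∀ a b, 0 ≤ e a b)
    {S : Set Plane} (hS : IsCompact S) (hSQ : S ⊆ unitSquare) {c p q K : ℝ} (hp : 0 ≤ p)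
    (hK : 0 ≤ K)
    (hA : ∀ b ∈ S, ∫ a in unitSquare, n a b ≤ K * ∫ a in unitSquare, e a b)
    (hB : ∀ a ∈ unitSquare, c * ∫ b in unitSquare, n a b
      ≤ p * (∫ b in S, n a b) + q * ∫ b in unitSquare, e b a) :
    c * ∫ a in unitSquare, ∫ b in unitSquare, n a b
      ≤ (p * K + q) * ∫ b in unitSquare, ∫ a in unitSquare, e a b := by
  have hQ := isCompact_unitSquare
  have iS : IntegrableOn (fun b => ∫ a in unitSquare, n a b) S :=
    integrableOn_setIntegral (h := fun p => n p.2 p.1) (hn.comp continuous_swap) hS hQ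
  have iQS : IntegrableOn (fun a => ∫ b in S, n a b) unitSquare :=
    integrableOn_setIntegral (h := fun p => n p.1 p.2) hn hQ hS
  have iQ : IntegrableOn (fun a => ∫ b in unitSquare, n a b) unitSquare :=
    integrableOn_setIntegral (h := fun p => n p.1 p.2) hn hQ hQ
  have jS : IntegrableOn (fun b => ∫ a in unitSquare, e a b) S :=
    integrableOn_setIntegral (h := fun p => e p.2 p.1) (he.comp continuous_swap) hS hQ
  have jQ : IntegrableOn (fun b => ∫ a in unitSquare, e a b) unitSquare :=
    integrableOn_setIntegral (h := fun p => e p.2 p.1) (he.comp continuous_swap) hQ hQ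
  have hswap : ∫ a in unitSquare, ∫ b in S, n a b = ∫ b in S, ∫ a in unitSquare, n a b :=
    setIntegral_integral_swap (h := fun p => n p.1 p.2) hn hQ hS
  have hinner : ∫ a in unitSquare, ∫ b in S, n a b
      ≤ K * ∫ b in unitSquare, ∫ a in unitSquare, e a b := by
    rw [hswap]
    calc ∫ b in S, ∫ a in unitSquare, n a b
        ≤ ∫ b in S, K * ∫ a in unitSquare, e a b :=
          setIntegral_mono_on iS (jS.const_mul K) hS.measurableSet hA
      _ = K * ∫ b in S, ∫ a in unitSquare, e a b := integral_const_mul _ _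
      _ ≤ _ := mul_le_mul_of_nonneg_left (setIntegral_mono_set jQ
          (Eventually.of_forall fun b => integral_nonneg fun a => he0 a b) hSQ.eventuallyLE) hK
  have houter := setIntegral_mono_on (iQ.const_mul c) ((iQS.const_mul p).add (jQ.const_mul q))
    measurableSet_unitSquare hB
  rw [integral_const_mul, integral_add' (iQS.const_mul p) (jQ.const_mul q), integral_const_mul,
    integral_const_mul] at houter
  nlinarith [mul_le_mul_of_nonneg_left hinner hp]

/-- The lower bound for two particles: `ψ` is symmetric, and vanishes near the diagonal. -/
lemma pair_lower_bound {ψ : Plane → Plane → ℂ} (hsymm : ∀ a b, ψ a b = ψ b a)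
    (hψ : Continuous fun p : Plane × Plane => ψ p.1 p.2)
    (hslice : ∀ b, ContDiff ℝ 1 fun a => ψ a b) {η : ℝ} (hη : 0 < η)
    (h0 : ∀ a b : Plane, (a.1 - b.1) ^ 2 + (a.2 - b.2) ^ 2 < η → ψ a b = 0) {α R δ : ℝ}
    (he : Continuous fun p : Plane × Plane => relDensity α p.2 (fun a => ψ a p.2) p.1)
    (hα : 0 < α) (hα' : α * (4 * Real.pi) ≤ 1) (hR : 0 < R) (hR' : R ≤ 1 / 2) (hδ : 0 < δ) :
    (1 - 2 * R) ^ 2 * ∫ a in unitSquare, ∫ b in unitSquare, ‖ψ a b‖ ^ 2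
      ≤ ((1 + δ) * ((1 + δ) / (2 * Real.pi * α) + (1 + δ⁻¹) * (4 / (Real.pi * R)))
          + (1 + δ⁻¹) * 2)
        * ∫ b in unitSquare, ∫ a in unitSquare, relDensity α b (fun a => ψ a b) a := by
  have hpi := Real.pi_pos
  have hI : Set.Icc R (1 - R) ⊆ Set.Icc (0 : ℝ) 1 := Set.Icc_subset_Icc hR.le (by linarith)
  have hδ' : 0 < δ⁻¹ := inv_pos.2 hδ
  refine setIntegral_setIntegral_le_of_slices (n := fun a b => ‖ψ a b‖ ^ 2)
    (e := fun a b => relDensity α b (fun a => ψ a b) a) (by fun_prop) he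
    (fun a b => relDensity_nonneg _ _ _ _) (isCompact_Icc.prod isCompact_Icc)
    (Set.prod_mono hI hI) (by positivity) (by positivity) (fun b hb => ?_) fun a _ => ?_
  · exact sq_norm_le_relDensity (hslice b) hη (fun a => h0 a b) hα hα' hR hR' hb hδ
  -- Now the first particle is fixed and the second one moves; by symmetry its energy is the same
  -- density with arguments exchanged.
  · have h := sq_norm_le_inner_square (hslice a) hη (fun b => h0 b a) α hR hR' hδ
    simp_rw [hsymm a]
    rw [mul_assoc (1 + δ⁻¹)]
    exact h

/-! ### Test functions on configuration space and their slices -/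

/-- The squared distance of the two particles. -/
def sqDist (x : Config 2) : ℝ := ((x 0).1 - (x 1).1) ^ 2 + ((x 0).2 - (x 1).2) ^ 2

lemma continuous_sqDist : Continuous sqDist := by unfold sqDist; fun_prop

lemma sqDist_nonneg (x : Config 2) : 0 ≤ sqDist x := by unfold sqDist; positivity

lemma mem_diagonals_of_sqDist_eq_zero {x : Config 2} (h : sqDist x = 0) : x ∈ diagonals 2 := by
  refine ⟨0, 1, by decide, ?_⟩
  unfold sqDist at h
  have h1 : ((x 0).1 - (x 1).1) ^ 2 = 0 := by
    nlinarith [sq_nonneg ((x 0).1 - (x 1).1), sq_nonneg ((x 0).2 - (x 1).2)]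
  have h2 : ((x 0).2 - (x 1).2) ^ 2 = 0 := by linarith
  exact Prod.ext (sub_eq_zero.1 (pow_eq_zero_iff two_ne_zero |>.1 h1))
    (sub_eq_zero.1 (pow_eq_zero_iff two_ne_zero |>.1 h2))

/-- On the compact support the squared distance attains a positive minimum. This uniform gap makes
every expression containing the singular potential continuous. -/
lemma IsCore.exists_vanishing {φ : Config 2 → ℂ} (hφ : IsCore φ) :
    ∃ η > 0, ∀ x, sqDist x < η → φ x = 0 := by
  rcases (tsupport φ).eq_empty_or_nonempty with h | h
  · refine ⟨1, one_pos, fun x _ => image_eq_zero_of_notMem_tsupport ?_⟩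
    simp [h]
  · obtain ⟨x₀, hx₀, hmin⟩ := hφ.compact.exists_isMinOn h continuous_sqDist.continuousOn
    refine ⟨sqDist x₀, (sqDist_nonneg _).lt_of_ne' fun h0 => ?_, fun x hx => ?_⟩
    · exact Set.disjoint_left.1 hφ.off_diagonal hx₀ (mem_diagonals_of_sqDist_eq_zero h0)
    · exact image_eq_zero_of_notMem_tsupport fun hmem => (hmin hmem).not_gt hx

lemma vecPot_zero_index (x : Config 2) : vecPot 0 x = perpInv (x 0 - x 1) := by
  have : (Finset.univ : Finset (Fin 2)).erase 0 = {1} := by decide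
  simp [vecPot, this]

lemma vecPot_one_index (x : Config 2) : vecPot 1 x = perpInv (x 1 - x 0) := by
  have : (Finset.univ : Finset (Fin 2)).erase 1 = {0} := by decide
  simp [vecPot, this]

lemma continuous_vecPot_mul {φ : Config 2 → ℂ} (hφ : Continuous φ) {η : ℝ} (hη : 0 < η)
    (h0 : ∀ x, sqDist x < η → φ x = 0) (α : ℝ) (j c : Fin 2) :
    Continuous fun x => ((α * component c (vecPot j x) : ℝ) : ℂ) * φ x := by
  have key : ∀ k : Config 2 → ℝ, Continuous k →
      Continuous fun x => ((k x / sqDist x : ℝ) : ℂ) * φ x := fun k hk =>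
    continuous_div_mul_of_vanishing hk continuous_sqDist hφ hη h0
  have hs : ∀ x : Config 2, ((x 1).1 - (x 0).1) ^ 2 + ((x 1).2 - (x 0).2) ^ 2 = sqDist x :=
    fun x => by unfold sqDist; ring
  fin_cases j <;> fin_cases c
  · refine (key (fun x => α * -((x 0).2 - (x 1).2)) (by fun_prop)).congr fun x => ?_
    simp [vecPot_zero_index, component, perpInv, sqDist, mul_div_assoc]
  · refine (key (fun x => α * ((x 0).1 - (x 1).1)) (by fun_prop)).congr fun x => ?_
    simp [vecPot_zero_index, component, perpInv, sqDist, mul_div_assoc]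
  · refine (key (fun x => α * -((x 1).2 - (x 0).2)) (by fun_prop)).congr fun x => ?_
    simp [vecPot_one_index, component, perpInv, hs, mul_div_assoc]
  · refine (key (fun x => α * ((x 1).1 - (x 0).1)) (by fun_prop)).congr fun x => ?_
    simp [vecPot_one_index, component, perpInv, hs, mul_div_assoc]

lemma IsCore.continuous_momentum {φ : Config 2 → ℂ} (hφ : IsCore φ) (α : ℝ) (j c : Fin 2) :
    Continuous (momentum α j c φ) := by
  obtain ⟨η, hη, h0⟩ := hφ.exists_vanishing
  have hd : Continuous (fderiv ℝ φ) := hφ.smooth.continuous_fderiv (by simp)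
  exact Continuous.add (by fun_prop) (continuous_vecPot_mul hφ.smooth.continuous hη h0 α j c)

lemma IsCore.hasCompactSupport_momentum {φ : Config 2 → ℂ} (hφ : IsCore φ) (α : ℝ) (j c : Fin 2) :
    HasCompactSupport (momentum α j c φ) := by
  have h1 : HasCompactSupport fun x => fderiv ℝ φ x (Pi.single j (unitVec c)) :=
    (hφ.compact.fderiv (𝕜 := ℝ)).comp_left (g := fun L : Config 2 →L[ℝ] ℂ => L _) (by simp)
  exact (h1.mul_left (f := fun _ => -Complex.I)).add hφ.compact.mul_left

lemma IsCore.memLp {φ : Config 2 → ℂ} (hφ : IsCore φ) : MemLp φ 2 volume :=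
  hφ.smooth.continuous.memLp_of_hasCompactSupport hφ.compact

lemma IsCore.memLp_momentum {φ : Config 2 → ℂ} (hφ : IsCore φ) (α : ℝ) (j c : Fin 2) :
    MemLp (momentum α j c φ) 2 volume :=
  (hφ.continuous_momentum α j c).memLp_of_hasCompactSupport (hφ.hasCompactSupport_momentum α j c)

lemma IsCore.inGraph {φ : Config 2 → ℂ} (hφ : IsCore φ) (α : ℝ) :
    InGraph α φ (fun j c => momentum α j c φ) where
  memLp := hφ.memLp
  memLp_momentum := hφ.memLp_momentum α
  approx := ⟨fun _ => φ, fun _ => hφ, by simp, by simp⟩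

/-- The magnetic kinetic energy density of a function on the two-particle configuration space. -/
def density (α : ℝ) (j : Fin 2) (φ : Config 2 → ℂ) (x : Config 2) : ℝ :=
  ∑ c, ‖momentum α j c φ x‖ ^ 2

lemma IsCore.continuous_density {φ : Config 2 → ℂ} (hφ : IsCore φ) (α : ℝ) (j : Fin 2) :
    Continuous (density α j φ) := by
  have := hφ.continuous_momentum α j
  unfold density
  fun_prop

lemma power_two_eq_preimage (Ω : Set Plane) :
    power 2 Ω = (MeasurableEquiv.finTwoArrow : Config 2 ≃ᵐ Plane × Plane) ⁻¹' (Ω ×ˢ Ω) := by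
  ext x
  simp [power, Set.mem_pi, Fin.forall_fin_two]

lemma continuous_pair : Continuous fun p : Plane × Plane => (![p.1, p.2] : Config 2) := by
  refine continuous_pi fun i => ?_
  fin_cases i
  · exact continuous_fst
  · exact continuous_snd

lemma setIntegral_power_eq_prod (G : Config 2 → ℝ) :
    ∫ x in power 2 unitSquare, G x
      = ∫ p in unitSquare ×ˢ unitSquare, G ![p.1, p.2] := by
  rw [power_two_eq_preimage, ← (volume_preserving_finTwoArrow Plane).setIntegral_preimage_emb
    MeasurableEquiv.finTwoArrow.measurableEmbedding (fun p => G ![p.1, p.2])]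
  congr 1
  ext x
  congr 1
  ext1 i
  fin_cases i <;> rfl

lemma setIntegral_power {G : Config 2 → ℝ} (hG : Continuous G) :
    ∫ x in power 2 unitSquare, G x
      = ∫ a in unitSquare, ∫ b in unitSquare, G ![a, b] := by
  rw [setIntegral_power_eq_prod, Measure.volume_eq_prod, setIntegral_prod]
  exact (hG.comp continuous_pair).continuousOn.integrableOn_compact
    (isCompact_unitSquare.prod isCompact_unitSquare)

lemma fderiv_update {φ : Config 2 → ℂ} (hφ : Differentiable ℝ φ) (x : Config 2) (j : Fin 2)
    (v : Plane) :
    fderiv ℝ (fun a => φ (Function.update x j a)) (x j) v = fderiv ℝ φ x (Pi.single j v) := by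
  have h1 := hasFDerivAt_update (𝕜 := ℝ) x (i := j) (x j)
  have h2 : HasFDerivAt φ (fderiv ℝ φ x) (Function.update x j (x j)) := by
    rw [Function.update_eq_self]
    exact (hφ x).hasFDerivAt
  have h3 := (h2.comp (x j) h1).fderiv
  rw [Function.comp_def] at h3
  rw [h3]
  simp only [ContinuousLinearMap.comp_apply]
  congr 1
  ext1 k
  rcases eq_or_ne k j with rfl | h
  · simp
  · simp [h]

/-- With one particle fixed, the momentum of the other involves only the slice, so the planar
estimates apply with the flux at the fixed particle. -/
lemma density_zero_index {φ : Config 2 → ℂ} (hφ : Differentiable ℝ φ) (α : ℝ) (a b : Plane) :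
    density α 0 φ ![a, b] = relDensity α b (fun a => φ ![a, b]) a := by
  have h := fderiv_update hφ ![a, b] 0
  have hu : ∀ a', Function.update (![a, b] : Config 2) 0 a' = ![a', b] := fun a' => by
    ext1 i; fin_cases i <;> rfl
  simp only [hu] at h
  simp only [density, relDensity, momentum, relMomentum, ← h, vecPot_zero_index]
  rfl

lemma density_one_index {φ : Config 2 → ℂ} (hφ : Differentiable ℝ φ) (α : ℝ) (a b : Plane) :
    density α 1 φ ![a, b] = relDensity α a (fun b => φ ![a, b]) b := by
  have h := fderiv_update hφ ![a, b] 1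
  have hu : ∀ b', Function.update (![a, b] : Config 2) 1 b' = ![a, b'] := fun a' => by
    ext1 i; fin_cases i <;> rfl
  simp only [hu] at h
  simp only [density, relDensity, momentum, relMomentum, ← h, vecPot_one_index]
  rfl

lemma IsCore.pair_symm {φ : Config 2 → ℂ} (hφ : IsCore φ) (a b : Plane) :
    φ ![a, b] = φ ![b, a] := by
  rw [← hφ.symmetric (Equiv.swap 0 1) ![a, b]]
  congr 1
  ext1 i
  fin_cases i <;> rfl

lemma IsCore.differentiable {φ : Config 2 → ℂ} (hφ : IsCore φ) : Differentiable ℝ φ :=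
  hφ.smooth.differentiable (by simp)

/-- Exchange symmetry gives both particles the same energy. The factor two turns `2πα` into `4πα`.
-/
lemma IsCore.setIntegral_density {φ : Config 2 → ℂ} (hφ : IsCore φ) (α : ℝ) :
    ∑ j, ∫ x in power 2 unitSquare, density α j φ x
      = 2 * ∫ b in unitSquare, ∫ a in unitSquare, relDensity α b (fun a => φ ![a, b]) a := by
  rw [Fin.sum_univ_two, setIntegral_power (hφ.continuous_density α 0),
    setIntegral_power (hφ.continuous_density α 1)]
  have h0 : ∫ a in unitSquare, ∫ b in unitSquare, density α 0 φ ![a, b]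
      = ∫ b in unitSquare, ∫ a in unitSquare, density α 0 φ ![a, b] :=
    setIntegral_integral_swap (h := fun p => density α 0 φ ![p.1, p.2])
      ((hφ.continuous_density α 0).comp continuous_pair) isCompact_unitSquare isCompact_unitSquare
  rw [h0, two_mul]
  simp_rw [density_zero_index hφ.differentiable, density_one_index hφ.differentiable,
    fun a => hφ.pair_symm a]

lemma IsCore.continuous_relDensity {φ : Config 2 → ℂ} (hφ : IsCore φ) (α : ℝ) :
    Continuous fun p : Plane × Plane => relDensity α p.2 (fun a => φ ![a, p.2]) p.1 := by
  simp_rw [← density_zero_index hφ.differentiable]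
  exact (hφ.continuous_density α 0).comp continuous_pair

/-- The lower bound for test functions. -/
lemma IsCore.lower_bound {φ : Config 2 → ℂ} (hφ : IsCore φ) {α R δ : ℝ}
    (hα : 0 < α) (hα' : α * (4 * Real.pi) ≤ 1) (hR : 0 < R) (hR' : R ≤ 1 / 2) (hδ : 0 < δ) :
    (1 - 2 * R) ^ 2 * ∫ x in power 2 unitSquare, ‖φ x‖ ^ 2
      ≤ ((1 + δ) * ((1 + δ) / (2 * Real.pi * α) + (1 + δ⁻¹) * (4 / (Real.pi * R)))
          + (1 + δ⁻¹) * 2) / 2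
        * ∑ j, ∫ x in power 2 unitSquare, density α j φ x := by
  obtain ⟨η, hη, h0⟩ := hφ.exists_vanishing
  have hc := hφ.smooth.continuous
  have h := pair_lower_bound (ψ := fun a b => φ ![a, b]) hφ.pair_symm (hc.comp continuous_pair)
    (fun b => ?_) hη (fun a b hab => h0 _ (by simpa [sqDist] using hab))
    (hφ.continuous_relDensity α) hα hα' hR hR' hδ
  · rw [hφ.setIntegral_density, setIntegral_power (by fun_prop)]
    refine h.trans_eq ?_
    ring
  · refine (hφ.smooth.of_le (by simp)).comp ?_
    refine contDiff_pi.2 fun i => ?_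
    fin_cases i
    · exact contDiff_id
    · exact contDiff_const

/-! ### Passage to the closure and the variational principle -/

lemma toReal_eLpNorm_sq {X : Type*} [MeasurableSpace X] {μ : Measure X} {f : X → ℂ}
    (hf : MemLp f 2 μ) : (eLpNorm f 2 μ).toReal ^ 2 = ∫ x, ‖f x‖ ^ 2 ∂μ := by
  rw [hf.eLpNorm_eq_integral_rpow_norm two_ne_zero ENNReal.ofNat_ne_top]
  have h0 : 0 ≤ ∫ x, ‖f x‖ ^ 2 ∂μ := integral_nonneg fun x => sq_nonneg _
  simp only [ENNReal.toReal_ofNat, Real.rpow_ofNat]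
  rw [ENNReal.toReal_ofReal (by positivity), ← Real.rpow_natCast, ← Real.rpow_mul h0]
  norm_num

lemma tendsto_setIntegral_sq_norm {X : Type*} [MeasurableSpace X] {μ : Measure X} {f : ℕ → X → ℂ}
    {g : X → ℂ} (hf : ∀ n, MemLp (f n) 2 μ) (hg : MemLp g 2 μ)
    (h : Tendsto (fun n => eLpNorm (f n - g) 2 μ) atTop (𝓝 0)) (s : Set X) :
    Tendsto (fun n => ∫ x in s, ‖f n x‖ ^ 2 ∂μ) atTop (𝓝 (∫ x in s, ‖g x‖ ^ 2 ∂μ)) := by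
  have hf' : ∀ n, MemLp (f n) 2 (μ.restrict s) := fun n => (hf n).restrict s
  have hg' : MemLp g 2 (μ.restrict s) := hg.restrict s
  have h' : Tendsto (fun n => eLpNorm (f n - g) 2 (μ.restrict s)) atTop (𝓝 0) :=
    tendsto_of_tendsto_of_tendsto_of_le_of_le tendsto_const_nhds h (fun _ => zero_le)
      fun n => eLpNorm_mono_measure _ Measure.restrict_le_self
  have : Fact ((1 : ENNReal) ≤ 2) := ⟨by norm_num⟩
  have hlim := ((Lp.tendsto_Lp_iff_tendsto_eLpNorm'' f hf' g hg').2 h').norm.pow 2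
  simp only [Lp.norm_toLp] at hlim
  rw [toReal_eLpNorm_sq hg'] at hlim
  simpa only [toReal_eLpNorm_sq (hf' _)] using hlim

/-- Both sides are continuous under `L²` convergence of the function and of its momenta, so the
inequality survives the closure that defines the form domain. -/
lemma InGraph.le_of_isCore_le {α c K : ℝ} {Ω : Set (Config 2)}
    (hcore : ∀ φ : Config 2 → ℂ, IsCore φ →
      c * ∫ x in Ω, ‖φ x‖ ^ 2 ≤ K * ∑ j, ∫ x in Ω, density α j φ x)
    {Ψ : Config 2 → ℂ} {Φ : Fin 2 → Fin 2 → Config 2 → ℂ} (h : InGraph α Ψ Φ) :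
    c * ∫ x in Ω, ‖Ψ x‖ ^ 2 ≤ K * ∑ j, ∫ x in Ω, ∑ c, ‖Φ j c x‖ ^ 2 := by
  obtain ⟨φ, hφ, h1, h2⟩ := h.approx
  have hsplit : ∀ (Θ : Fin 2 → Fin 2 → Config 2 → ℂ), (∀ j c, MemLp (Θ j c) 2 volume) → ∀ j,
      ∫ x in Ω, ∑ c, ‖Θ j c x‖ ^ 2 = ∑ c, ∫ x in Ω, ‖Θ j c x‖ ^ 2 := fun Θ hΘ j =>
    integral_finsetSum _ fun c _ => ((hΘ j c).restrict Ω).integrable_norm_pow two_ne_zero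
  have hlim1 := tendsto_setIntegral_sq_norm (fun n => (hφ n).memLp) h.memLp h1 Ω
  have hlim2 : Tendsto (fun n => ∑ j, ∫ x in Ω, density α j (φ n) x) atTop
      (𝓝 (∑ j, ∫ x in Ω, ∑ c, ‖Φ j c x‖ ^ 2)) := by
    refine tendsto_finsetSum _ fun j _ => ?_
    rw [hsplit Φ h.memLp_momentum]
    have : ∀ n, ∫ x in Ω, density α j (φ n) x
        = ∑ c, ∫ x in Ω, ‖momentum α j c (φ n) x‖ ^ 2 := fun n =>
      hsplit (fun j c => momentum α j c (φ n)) ((hφ n).memLp_momentum α) j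
    simp_rw [this]
    exact tendsto_finsetSum _ fun c _ => tendsto_setIntegral_sq_norm
      (fun n => (hφ n).memLp_momentum α j c) (h.memLp_momentum j c) (h2 j c) Ω
  exact le_of_tendsto_of_tendsto' (hlim1.const_mul c) (hlim2.const_mul K) fun n => hcore _ (hφ n)

lemma momentum_const_mul {φ : Config 2 → ℂ} (hφ : Differentiable ℝ φ) (α : ℝ) (j c : Fin 2)
    (k : ℂ) (x : Config 2) :
    momentum α j c (fun x => k * φ x) x = k * momentum α j c φ x := by
  simp only [momentum, fderiv_const_mul (hφ x) k, smul_apply, smul_eq_mul]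
  ring

lemma IsCore.const_mul {φ : Config 2 → ℂ} (hφ : IsCore φ) (k : ℂ) : IsCore fun x => k * φ x where
  smooth := contDiff_const.mul hφ.smooth
  compact := hφ.compact.mul_left
  off_diagonal := hφ.off_diagonal.mono_left (tsupport_mul_subset_right (f := fun _ => k))
  symmetric σ x := by rw [hφ.symmetric]

lemma IsCore.exists_normalized {φ : Config 2 → ℂ} (hφ : IsCore φ) (α : ℝ)
    (hN : 0 < ∫ x in power 2 unitSquare, ‖φ x‖ ^ 2) :
    (∑ j, ∫ x in power 2 unitSquare, density α j φ x) / ∫ x in power 2 unitSquare, ‖φ x‖ ^ 2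
      ∈ {e : ℝ | ∃ (Ψ : Config 2 → ℂ) (Φ : Fin 2 → Fin 2 → Config 2 → ℂ),
        InGraph α Ψ Φ ∧ ∫ x in power 2 unitSquare, ‖Ψ x‖ ^ 2 = 1 ∧
        e = ∑ j, ∫ x in power 2 unitSquare, ∑ c, ‖Φ j c x‖ ^ 2} := by
  set N := ∫ x in power 2 unitSquare, ‖φ x‖ ^ 2 with hNdef
  set k : ℂ := (((√N)⁻¹ : ℝ) : ℂ) with hk
  have hk2 : ‖k‖ ^ 2 = N⁻¹ := by
    rw [hk, Complex.norm_real, Real.norm_eq_abs, sq_abs, inv_pow, Real.sq_sqrt hN.le]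
  refine ⟨_, _, (hφ.const_mul k).inGraph α, ?_, ?_⟩
  · simp_rw [norm_mul, mul_pow, hk2]
    rw [integral_const_mul, ← hNdef, inv_mul_cancel₀ hN.ne']
  · simp_rw [momentum_const_mul hφ.differentiable, norm_mul, mul_pow, hk2, ← Finset.mul_sum]
    simp_rw [integral_const_mul]
    rw [← Finset.mul_sum, div_eq_inv_mul]
    rfl

lemma neumannEnergy_le {φ : Config 2 → ℂ} (hφ : IsCore φ) (α : ℝ)
    (hN : 0 < ∫ x in power 2 unitSquare, ‖φ x‖ ^ 2) :
    neumannEnergy 2 α ≤ (∑ j, ∫ x in power 2 unitSquare, density α j φ x)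
      / ∫ x in power 2 unitSquare, ‖φ x‖ ^ 2 := by
  refine csInf_le ⟨0, ?_⟩ (hφ.exists_normalized α hN)
  rintro e ⟨Ψ, Φ, -, -, rfl⟩
  exact Finset.sum_nonneg fun j _ => integral_nonneg fun x => Finset.sum_nonneg fun c _ =>
    sq_nonneg _

/-- The given `φ` only shows that the set of energies is nonempty; the infimum of the empty set
would be `0` by convention. -/
lemma le_neumannEnergy {φ : Config 2 → ℂ} (hφ : IsCore φ)
    (hN : 0 < ∫ x in power 2 unitSquare, ‖φ x‖ ^ 2) {α c K : ℝ} (hK : 0 < K)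
    (hcore : ∀ φ : Config 2 → ℂ, IsCore φ → c * ∫ x in power 2 unitSquare, ‖φ x‖ ^ 2
      ≤ K * ∑ j, ∫ x in power 2 unitSquare, density α j φ x) :
    c / K ≤ neumannEnergy 2 α := by
  refine le_csInf ⟨_, hφ.exists_normalized α hN⟩ ?_
  rintro e ⟨Ψ, Φ, h1, h2, rfl⟩
  have := h1.le_of_isCore_le hcore
  rw [h2, mul_one] at this
  rwa [div_le_iff₀' hK]

/-! ### The trial function -/

/-- The trial profile `t ↦ t^{α/2}` in the variable `t = |𝐱₁ - 𝐱₂|²`, cut off below `t = ε`. -/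
def profile (α ε t : ℝ) : ℝ := t ^ (α / 2) * Real.smoothTransition (t / ε - 1)

lemma profile_of_le {α ε t : ℝ} (hε : 0 < ε) (ht : t ≤ ε) : profile α ε t = 0 := by
  rw [profile, Real.smoothTransition.zero_of_nonpos, mul_zero]
  rw [sub_nonpos, div_le_one hε]
  exact ht

lemma profile_of_ge {α ε t : ℝ} (hε : 0 < ε) (ht : 2 * ε ≤ t) : profile α ε t = t ^ (α / 2) := by
  rw [profile, Real.smoothTransition.one_of_one_le, mul_one]
  rw [le_sub_iff_add_le, le_div_iff₀ hε]
  linarith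

lemma contDiff_profile (α : ℝ) {ε : ℝ} (hε : 0 < ε) : ContDiff ℝ ∞ (profile α ε) := by
  rw [contDiff_iff_contDiffAt]
  intro t
  rcases lt_or_ge t ε with h | h
  · have : profile α ε =ᶠ[𝓝 t] fun _ => 0 := by
      filter_upwards [Iio_mem_nhds h] with s hs using profile_of_le hε (le_of_lt hs)
    exact contDiffAt_const.congr_of_eventuallyEq this
  · have ht : t ≠ 0 := (hε.trans_le h).ne'
    exact (Real.contDiffAt_rpow_const_of_ne ht).mul
      (Real.smoothTransition.contDiff.contDiffAt.comp t (by fun_prop))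

lemma exists_abs_deriv_smoothTransition_le :
    ∃ M : ℝ, ∀ x ∈ Set.Icc (0 : ℝ) 1, |deriv Real.smoothTransition x| ≤ M := by
  have hc : Continuous (deriv Real.smoothTransition) :=
    (Real.smoothTransition.contDiff (n := 1)).continuous_deriv le_rfl
  obtain ⟨M, hM⟩ := isCompact_Icc.exists_bound_of_continuousOn (hc.continuousOn (s := Set.Icc 0 1))
  exact ⟨M, fun x hx => hM x hx⟩

/-- The energy density of the trial profile, as a function of the squared distance. -/
def profileDensity (α ε t : ℝ) : ℝ :=
  4 * t * deriv (profile α ε) t ^ 2 + α ^ 2 * (profile α ε t ^ 2 / t)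

lemma rpow_half_sq {t : ℝ} (ht : 0 < t) (β : ℝ) : (t ^ (β / 2)) ^ 2 = t ^ β := by
  rw [← Real.rpow_natCast, ← Real.rpow_mul ht.le]
  norm_num

lemma hasDerivAt_rpow_half {t : ℝ} (ht : 0 < t) (α : ℝ) :
    HasDerivAt (fun t : ℝ => t ^ (α / 2)) (α / 2 * t ^ (α / 2) / t) t := by
  have := Real.hasDerivAt_rpow_const (p := α / 2) (Or.inl ht.ne')
  rwa [Real.rpow_sub_one ht.ne', ← mul_div_assoc] at this

/-- For the pure power the radial and the potential terms both equal `α² t^{α-1}`, the equality case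
of the square completed in `radial_lower_bound`. The cutoff adds `O(ε^{α-1})` on a region whose area
is `O(ε)`. -/
lemma profileDensity_le {M : ℝ} (hM : ∀ x ∈ Set.Icc (0 : ℝ) 1, |deriv Real.smoothTransition x| ≤ M)
    {α ε t : ℝ} (hα : 0 < α) (hα' : α ≤ 1) (hε : 0 < ε) (ht : 0 ≤ t) :
    profileDensity α ε t ≤ 2 * α ^ 2 * t ^ (α - 1)
      + (Set.Iio (3 * ε)).indicator (fun _ => (1 + 32 * M ^ 2) * ε ^ (α - 1)) t := by
  have hA : 0 ≤ 2 * α ^ 2 * t ^ (α - 1) := by positivity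
  have hB : 0 ≤ (1 + 32 * M ^ 2) * ε ^ (α - 1) := by positivity
  have hI : 0 ≤ (Set.Iio (3 * ε)).indicator (fun _ => (1 + 32 * M ^ 2) * ε ^ (α - 1)) t :=
    Set.indicator_nonneg (fun _ _ => hB) t
  rcases lt_or_ge t ε with h1 | h1
  · have h2 : profile α ε =ᶠ[𝓝 t] fun _ => 0 := by
      filter_upwards [Iio_mem_nhds h1] with s hs using profile_of_le hε (le_of_lt hs)
    have h3 : profileDensity α ε t = 0 := by
      rw [profileDensity, h2.deriv_eq, h2.eq_of_nhds]
      simp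
    rw [h3]
    positivity
  have ht0 : 0 < t := hε.trans_le h1
  have hq : t ^ (α - 1) = t ^ α / t := Real.rpow_sub_one ht0.ne' α
  have hsq := rpow_half_sq ht0 α
  rcases lt_or_ge (2 * ε) t with h2 | h2
  · have h3 : profile α ε =ᶠ[𝓝 t] fun t => t ^ (α / 2) := by
      filter_upwards [Ioi_mem_nhds h2] with s hs using profile_of_ge hε (le_of_lt hs)
    have h4 : profileDensity α ε t = 2 * α ^ 2 * t ^ (α - 1) := by
      rw [profileDensity, h3.deriv_eq, h3.eq_of_nhds, (hasDerivAt_rpow_half ht0 α).deriv, hq,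
        ← hsq]
      field_simp
      ring
    rw [h4]
    linarith
  -- The transition reaches `t = 2 * ε` inclusive; `3 * ε` leaves room for the open half-line.
  · rw [Set.indicator_of_mem (show t ∈ Set.Iio (3 * ε) from by
      simp only [Set.mem_Iio]; linarith)]
    set x := t / ε - 1 with hx
    have hxI : x ∈ Set.Icc (0 : ℝ) 1 := by
      constructor
      · rw [hx, sub_nonneg, le_div_iff₀ hε]; linarith
      · rw [hx, sub_le_iff_le_add, div_le_iff₀ hε]; linarith
    set s := Real.smoothTransition x with hs
    set s' := deriv Real.smoothTransition x with hs'
    have hs0 : 0 ≤ s := Real.smoothTransition.nonneg x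
    have hs1 : s ≤ 1 := Real.smoothTransition.le_one x
    have hs2 : s ^ 2 ≤ 1 := by nlinarith
    have hs'M : s' ^ 2 ≤ M ^ 2 := sq_le_sq' (by linarith [abs_le.1 (hM x hxI)]) (abs_le.1 (hM x hxI)).2
    have hder : HasDerivAt (profile α ε)
        (α / 2 * t ^ (α / 2) / t * s + t ^ (α / 2) * (s' * (1 / ε))) t := by
      have h5 : HasDerivAt Real.smoothTransition s' x :=
        ((Real.smoothTransition.contDiff (n := 1)).differentiable one_ne_zero x).hasDerivAt
      have h6 : HasDerivAt (fun t : ℝ => t / ε - 1) (1 / ε) t :=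
        ((hasDerivAt_id t).div_const ε).sub_const 1
      have h7 : HasDerivAt (fun t : ℝ => Real.smoothTransition (t / ε - 1)) (s' * (1 / ε)) t :=
        HasDerivAt.comp (h₂ := Real.smoothTransition) t h5 h6
      exact (hasDerivAt_rpow_half ht0 α).mul h7
    have hval : profile α ε t = t ^ (α / 2) * s := rfl
    have hta : 0 < t ^ α := Real.rpow_pos_of_pos ht0 α
    -- The coefficient `3α²` is `2α²` from the derivative of the power plus `α²` from the potential.
    -- The surplus `α²` and `8M²·4` later make up `1 + 32M²`.
    have h7 : profileDensity α ε t ≤ 3 * α ^ 2 * (t ^ α / t) + 8 * M ^ 2 * (t * t ^ α / ε ^ 2) := by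
      have h8 : profileDensity α ε t = 4 * t * t ^ α * (α / 2 / t * s + s' / ε) ^ 2
          + α ^ 2 * (t ^ α / t) * s ^ 2 := by
        rw [profileDensity, hder.deriv, hval, ← hsq]
        field_simp
      have h9 : (α / 2 / t * s + s' / ε) ^ 2 ≤ 2 * ((α / 2 / t) ^ 2 * 1 + M ^ 2 / ε ^ 2) := by
        calc (α / 2 / t * s + s' / ε) ^ 2
            ≤ 2 * ((α / 2 / t) ^ 2 * s ^ 2 + s' ^ 2 / ε ^ 2) := by
              have : s' ^ 2 / ε ^ 2 = (s' / ε) ^ 2 := by rw [div_pow]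
              rw [this]
              nlinarith [sq_nonneg (α / 2 / t * s - s' / ε)]
          _ ≤ _ := by gcongr
      calc profileDensity α ε t
          ≤ 4 * t * t ^ α * (2 * ((α / 2 / t) ^ 2 * 1 + M ^ 2 / ε ^ 2))
            + α ^ 2 * (t ^ α / t) * 1 := by
            rw [h8]; gcongr
        _ = _ := by field_simp; ring
    have h10 : t ^ α / t ≤ ε ^ (α - 1) := by
      rw [← hq]
      exact Real.rpow_le_rpow_of_nonpos hε h1 (by linarith)
    have h11 : t * t ^ α / ε ^ 2 ≤ 4 * ε ^ (α - 1) := by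
      have h12 : t ^ α ≤ 2 * ε ^ α := by
        calc t ^ α ≤ (2 * ε) ^ α := Real.rpow_le_rpow ht0.le h2 hα.le
          _ = 2 ^ α * ε ^ α := Real.mul_rpow (by norm_num) hε.le
          _ ≤ 2 ^ (1 : ℝ) * ε ^ α := by
            gcongr
            norm_num
          _ = 2 * ε ^ α := by rw [Real.rpow_one]
      rw [Real.rpow_sub_one hε.ne']
      calc t * t ^ α / ε ^ 2 ≤ (2 * ε) * (2 * ε ^ α) / ε ^ 2 := by gcongr
        _ = _ := by field_simp; ring
    have h13 : α ^ 2 * (t ^ α / t) ≤ 1 * ε ^ (α - 1) := by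
      gcongr
      nlinarith
    rw [hq]
    nlinarith [mul_le_mul_of_nonneg_left h11 (sq_nonneg M)]

/-- A smooth cutoff, equal to one near the unit square. -/
def planeBump : ContDiffBump (0 : Plane) := ⟨2, 3, by norm_num, by norm_num⟩

lemma planeBump_eq_one {a : Plane} (ha : a ∈ unitSquare) : planeBump a = 1 := by
  refine planeBump.one_of_mem_closedBall ?_
  obtain ⟨⟨h1, h2⟩, h3, h4⟩ := ha
  rw [mem_closedBall_zero_iff, Prod.norm_def, Real.norm_eq_abs, Real.norm_eq_abs,
    abs_of_nonneg h1, abs_of_nonneg h3]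
  have : planeBump.rIn = 2 := rfl
  rw [this]
  exact max_le (by linarith) (by linarith)

lemma planeBump_eventually_eq_one {a : Plane} (ha : a ∈ unitSquare) :
    ∀ᶠ a' in 𝓝 a, planeBump a' = 1 := by
  refine planeBump.eventuallyEq_one_of_mem_ball ?_
  obtain ⟨⟨h1, h2⟩, h3, h4⟩ := ha
  rw [mem_ball_zero_iff, Prod.norm_def, Real.norm_eq_abs, Real.norm_eq_abs,
    abs_of_nonneg h1, abs_of_nonneg h3]
  have : planeBump.rIn = 2 := rfl
  rw [this]
  exact max_lt (by linarith) (by linarith)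

/-- The trial function. -/
def trial (α ε : ℝ) (x : Config 2) : ℂ :=
  ((planeBump (x 0) * planeBump (x 1) * profile α ε (sqDist x) : ℝ) : ℂ)

lemma isCore_trial (α : ℝ) {ε : ℝ} (hε : 0 < ε) : IsCore (trial α ε) where
  smooth := by
    refine Complex.ofRealCLM.contDiff.comp ?_
    have h1 : ContDiff ℝ ∞ sqDist := by unfold sqDist; fun_prop
    have h2 : ∀ j : Fin 2, ContDiff ℝ ∞ fun x : Config 2 => planeBump (x j) := fun j =>
      planeBump.contDiff.comp (by fun_prop)
    exact ((h2 0).mul (h2 1)).mul ((contDiff_profile α hε).comp h1)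
  compact := by
    refine HasCompactSupport.of_support_subset_isCompact (isCompact_closedBall (0 : Config 2) 3) ?_
    intro x hx
    by_contra hnot
    refine hx ?_
    rw [mem_closedBall_zero_iff, pi_norm_le_iff_of_nonneg (by norm_num)] at hnot
    push Not at hnot
    obtain ⟨j, hj⟩ := hnot
    have h0 : planeBump (x j) = 0 := planeBump.zero_of_le_dist (by
      rw [dist_zero_right]; exact hj.le)
    have : j = 0 ∨ j = 1 := by fin_cases j <;> simp
    rcases this with rfl | rfl <;> simp [trial, h0]
  off_diagonal := by
    have hsub : tsupport (trial α ε) ⊆ {x | ε ≤ sqDist x} := by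
      refine closure_minimal (fun x hx => ?_) (isClosed_le continuous_const continuous_sqDist)
      by_contra hnot
      refine hx ?_
      simp only [Set.mem_ofPred_eq, not_le] at hnot
      simp [trial, profile_of_le hε hnot.le]
    refine Set.disjoint_left.2 fun x hx hd => ?_
    have h1 : ε ≤ sqDist x := hsub hx
    have h2 : x 0 = x 1 := by
      obtain ⟨j, k, hjk, h⟩ := hd
      fin_cases j <;> fin_cases k <;> simp_all
    have h3 : sqDist x = 0 := by simp [sqDist, h2]
    linarith
  symmetric σ x := by
    have hσ : ∀ σ : Equiv.Perm (Fin 2), (σ 0 = 0 ∧ σ 1 = 1) ∨ (σ 0 = 1 ∧ σ 1 = 0) := by decide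
    rcases hσ σ with ⟨h0, h1⟩ | ⟨h0, h1⟩
    · simp [trial, sqDist, h0, h1]
    · have : sqDist (x ∘ σ) = sqDist x := by
        simp only [sqDist, Function.comp_apply, h0, h1]
        ring
      simp only [trial, this, Function.comp_apply, h0, h1]
      rw [mul_comm (planeBump (x 1))]

lemma trial_pair {α ε : ℝ} {a b : Plane} (ha : a ∈ unitSquare) (hb : b ∈ unitSquare) :
    trial α ε ![a, b] = (profile α ε ((a.1 - b.1) ^ 2 + (a.2 - b.2) ^ 2) : ℂ) := by
  simp [trial, sqDist, planeBump_eq_one ha, planeBump_eq_one hb]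

lemma sq_norm_neg_I_mul_add (p q : ℝ) : ‖-Complex.I * (p : ℂ) + (q : ℂ)‖ ^ 2 = p ^ 2 + q ^ 2 := by
  rw [Complex.sq_norm, Complex.normSq_apply]
  simp
  ring

/-- The trial function is real near these points, so gradient and potential do not interfere, and
the squared length of the potential is `α²/t`. -/
lemma relDensity_trial {α ε : ℝ} (hε : 0 < ε) {a b : Plane} (ha : a ∈ unitSquare)
    (hb : b ∈ unitSquare) :
    relDensity α b (fun a => trial α ε ![a, b]) a
      = profileDensity α ε ((a.1 - b.1) ^ 2 + (a.2 - b.2) ^ 2) := by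
  set t := (a.1 - b.1) ^ 2 + (a.2 - b.2) ^ 2 with ht
  have hloc : (fun a => trial α ε ![a, b])
      =ᶠ[𝓝 a] fun a : Plane => (profile α ε ((a.1 - b.1) ^ 2 + (a.2 - b.2) ^ 2) : ℂ) := by
    filter_upwards [planeBump_eventually_eq_one ha] with a' ha'
    simp [trial, sqDist, ha', planeBump_eq_one hb]
  have hg : HasFDerivAt (fun a : Plane => (a.1 - b.1) ^ 2 + (a.2 - b.2) ^ 2)
      ((2 * (a.1 - b.1)) • ContinuousLinearMap.fst ℝ ℝ ℝ
        + (2 * (a.2 - b.2)) • ContinuousLinearMap.snd ℝ ℝ ℝ) a := by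
    have h1 := ((hasFDerivAt_fst (𝕜 := ℝ) (p := a)).sub_const b.1).pow 2
    have h2 := ((hasFDerivAt_snd (𝕜 := ℝ) (p := a)).sub_const b.2).pow 2
    refine (h1.add h2).congr_fderiv ?_
    ext <;> simp
  have hp : HasDerivAt (fun t => (profile α ε t : ℂ)) ((deriv (profile α ε) t : ℝ) : ℂ) t :=
    ((contDiff_profile α hε).differentiable (by simp) t).hasDerivAt.ofReal_comp
  have hder := (hp.hasFDerivAt.comp a hg).fderiv
  rw [Function.comp_def] at hder
  have hd1 : fderiv ℝ (fun a => trial α ε ![a, b]) a (1, 0)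
      = ((2 * (a.1 - b.1) * deriv (profile α ε) t : ℝ) : ℂ) := by
    rw [hloc.fderiv_eq, hder]
    simp
  have hd2 : fderiv ℝ (fun a => trial α ε ![a, b]) a (0, 1)
      = ((2 * (a.2 - b.2) * deriv (profile α ε) t : ℝ) : ℂ) := by
    rw [hloc.fderiv_eq, hder]
    simp
  rw [relDensity, Fin.sum_univ_two, relMomentum_zero_index, relMomentum_one_index, hd1, hd2,
    trial_pair ha hb, ← ht, ← Complex.ofReal_mul, ← Complex.ofReal_mul, sq_norm_neg_I_mul_add,
    sq_norm_neg_I_mul_add, profileDensity]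
  have h3 : 4 * t * deriv (profile α ε) t ^ 2
      = 4 * ((a.1 - b.1) ^ 2 + (a.2 - b.2) ^ 2) * deriv (profile α ε) t ^ 2 := rfl
  -- At coinciding points the quotients by `t` are zero by convention.
  rcases eq_or_ne t 0 with h0 | h0
  · rw [h3]
    simp [h0]
    ring
  · rw [h3]
    have h4 : α ^ 2 * (profile α ε t ^ 2 / t)
        = α ^ 2 * profile α ε t ^ 2 * ((a.1 - b.1) ^ 2 + (a.2 - b.2) ^ 2) / t ^ 2 := by
      rw [← ht]
      field_simp
    rw [h4]
    field_simp
    ring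

/-! ### Energy and norm of the trial function -/

lemma unitSquare_subset_disc {b : Plane} (hb : b ∈ unitSquare) :
    unitSquare ⊆ (fun a => a - b) ⁻¹' disc 2 := by
  intro a ha
  obtain ⟨⟨h1, h2⟩, h3, h4⟩ := ha
  obtain ⟨⟨h5, h6⟩, h7, h8⟩ := hb
  change (a.1 - b.1) ^ 2 + (a.2 - b.2) ^ 2 < 2 ^ 2
  nlinarith

/-- The divergence of order `1/α` is what lowers the energy from order `α²` to order `α`. -/
lemma setIntegral_disc_rpow {α : ℝ} (hα : 0 < α) :
    ∫ a in disc 2, (a.1 ^ 2 + a.2 ^ 2) ^ (α - 1) = Real.pi * 4 ^ α / α := by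
  rw [setIntegral_disc_radial zero_le_two fun t => t ^ (α - 1)]
  have h1 : ∫ s in (0 : ℝ)..2, s * (s ^ 2) ^ (α - 1) = ∫ s in (0 : ℝ)..2, s ^ (2 * α - 1) := by
    refine intervalIntegral.integral_congr_ae (Eventually.of_forall fun s hs => ?_)
    rw [Set.uIoc_of_le zero_le_two] at hs
    have hs0 := hs.1
    rw [← Real.rpow_natCast s 2, ← Real.rpow_mul hs0.le]
    nth_rewrite 1 [← Real.rpow_one s]
    rw [← Real.rpow_add hs0]
    congr 1
    push_cast
    ring
  rw [h1, integral_rpow (Or.inl (by linarith)), sub_add_cancel, Real.zero_rpow (by positivity),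
    Real.rpow_mul zero_le_two]
  norm_num
  field_simp

lemma setIntegral_unitSquare_rpow_le {α : ℝ} (hα : 0 < α) {b : Plane} (hb : b ∈ unitSquare) :
    IntegrableOn (fun a : Plane => ((a.1 - b.1) ^ 2 + (a.2 - b.2) ^ 2) ^ (α - 1)) unitSquare ∧
    ∫ a in unitSquare, ((a.1 - b.1) ^ 2 + (a.2 - b.2) ^ 2) ^ (α - 1) ≤ Real.pi * 4 ^ α / α := by
  have hpi := Real.pi_pos
  set g : Plane → ℝ := fun a => ((a.1 - b.1) ^ 2 + (a.2 - b.2) ^ 2) ^ (α - 1) with hg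
  have h1 : ∫ a in (fun a => a - b) ⁻¹' disc 2, g a = Real.pi * 4 ^ α / α := by
    rw [setIntegral_disc_translate, ← setIntegral_disc_rpow hα]
    simp [hg]
  have h2 : IntegrableOn g ((fun a => a - b) ⁻¹' disc 2) := by
    -- Integrability follows from the value of the integral: a non-integrable function would have
    -- integral `0`.
    by_contra h
    have h3 : ∫ a in (fun a => a - b) ⁻¹' disc 2, g a = 0 := integral_undef h
    rw [h1] at h3
    have : 0 < Real.pi * 4 ^ α / α := by positivity
    linarith
  refine ⟨h2.mono_set (unitSquare_subset_disc hb), ?_⟩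
  rw [← h1]
  exact setIntegral_mono_set h2 (Eventually.of_forall fun a => by positivity)
    (unitSquare_subset_disc hb).eventuallyLE

lemma setIntegral_indicator_near_le (b : Plane) {ρ k : ℝ} (hρ : 0 ≤ ρ) (hk : 0 ≤ k) :
    IntegrableOn (fun a : Plane =>
      (Set.Iio ρ).indicator (fun _ => k) ((a.1 - b.1) ^ 2 + (a.2 - b.2) ^ 2)) unitSquare ∧
    ∫ a in unitSquare, (Set.Iio ρ).indicator (fun _ => k) ((a.1 - b.1) ^ 2 + (a.2 - b.2) ^ 2)
      ≤ k * (Real.pi * ρ) := by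
  set T : Set Plane := (fun a => a - b) ⁻¹' disc √ρ with hT
  have hTm : MeasurableSet T := measurable_id.sub_const b (measurableSet_disc _)
  have hvol : volume.real T = Real.pi * ρ := by
    rw [hT, volume_real_disc_translate b (Real.sqrt_nonneg _), Real.sq_sqrt hρ]
  have heq : (fun a : Plane => (Set.Iio ρ).indicator (fun _ => k)
      ((a.1 - b.1) ^ 2 + (a.2 - b.2) ^ 2)) = T.indicator fun _ => k := by
    ext a
    simp only [Set.indicator, hT, Set.mem_preimage, disc, Set.mem_ofPred_eq, Set.mem_Iio,
      Prod.fst_sub, Prod.snd_sub, Real.sq_sqrt hρ]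
  have hfin : volume T ≠ ⊤ := by
    rw [hT, (measurePreserving_sub_right volume b).measure_preimage
      (measurableSet_disc _).nullMeasurableSet]
    exact ((measure_mono (disc_subset (Real.sqrt_nonneg ρ))).trans_lt
      (isCompact_Icc.prod isCompact_Icc).measure_lt_top).ne
  have hint : Integrable (T.indicator fun _ => k) :=
    (integrable_indicator_iff hTm).2 (integrableOn_const hfin)
  rw [heq]
  refine ⟨hint.integrableOn, ?_⟩
  refine (setIntegral_le_integral hint
    (Eventually.of_forall fun a => Set.indicator_nonneg (fun _ _ => hk) a)).trans_eq ?_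
  rw [integral_indicator hTm, setIntegral_const, hvol, smul_eq_mul, mul_comm]

lemma setIntegral_setIntegral_le_const {e : Plane → Plane → ℝ}
    (he : Continuous fun p : Plane × Plane => e p.1 p.2) {k : ℝ}
    (h : ∀ b ∈ unitSquare, ∫ a in unitSquare, e a b ≤ k) :
    ∫ b in unitSquare, ∫ a in unitSquare, e a b ≤ k := by
  have hint : IntegrableOn (fun b => ∫ a in unitSquare, e a b) unitSquare :=
    integrableOn_setIntegral (h := fun p => e p.2 p.1) (he.comp continuous_swap)
      isCompact_unitSquare isCompact_unitSquare
  have h' := setIntegral_mono_on hint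
    (continuous_const.continuousOn.integrableOn_compact isCompact_unitSquare)
    measurableSet_unitSquare h
  rwa [setIntegral_unitSquare_const] at h'

lemma const_le_setIntegral_setIntegral {n : Plane → Plane → ℝ}
    (hn : Continuous fun p : Plane × Plane => n p.1 p.2) {k : ℝ}
    (h : ∀ a ∈ unitSquare, k ≤ ∫ b in unitSquare, n a b) :
    k ≤ ∫ a in unitSquare, ∫ b in unitSquare, n a b := by
  have hint : IntegrableOn (fun a => ∫ b in unitSquare, n a b) unitSquare :=
    integrableOn_setIntegral (h := fun p => n p.1 p.2) hn isCompact_unitSquare isCompact_unitSquare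
  have h' := setIntegral_mono_on
    (continuous_const.continuousOn.integrableOn_compact isCompact_unitSquare) hint
    measurableSet_unitSquare h
  rwa [setIntegral_unitSquare_const] at h'

lemma IsCore.continuous_relDensity_slice {φ : Config 2 → ℂ} (hφ : IsCore φ) (α : ℝ) (b : Plane) :
    Continuous (relDensity α b fun a => φ ![a, b]) := by
  rw [← funext fun a => density_zero_index hφ.differentiable α a b]
  exact (hφ.continuous_density α 0).comp
    (continuous_pair.comp (by fun_prop : Continuous fun a : Plane => (a, b)))

lemma slice_energy_trial_le {M : ℝ}
    (hM : ∀ x ∈ Set.Icc (0 : ℝ) 1, |deriv Real.smoothTransition x| ≤ M)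
    {α ε : ℝ} (hα : 0 < α) (hα' : α ≤ 1) (hε : 0 < ε) {b : Plane} (hb : b ∈ unitSquare) :
    ∫ a in unitSquare, relDensity α b (fun a => trial α ε ![a, b]) a
      ≤ 2 * α ^ 2 * (Real.pi * 4 ^ α / α)
        + (1 + 32 * M ^ 2) * ε ^ (α - 1) * (Real.pi * (3 * ε)) := by
  set B := (1 + 32 * M ^ 2) * ε ^ (α - 1) with hB
  have hB0 : 0 ≤ B := by positivity
  obtain ⟨i1, l1⟩ := setIntegral_unitSquare_rpow_le hα hb
  obtain ⟨i2, l2⟩ := setIntegral_indicator_near_le b (ρ := 3 * ε) (by positivity) hB0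
  have i0 : IntegrableOn (relDensity α b fun a => trial α ε ![a, b]) unitSquare :=
    ((isCore_trial α hε).continuous_relDensity_slice α b).continuousOn.integrableOn_compact
      isCompact_unitSquare
  have h1 : ∫ a in unitSquare, relDensity α b (fun a => trial α ε ![a, b]) a
      ≤ ∫ a in unitSquare, (2 * α ^ 2 * ((a.1 - b.1) ^ 2 + (a.2 - b.2) ^ 2) ^ (α - 1)
        + (Set.Iio (3 * ε)).indicator (fun _ => B) ((a.1 - b.1) ^ 2 + (a.2 - b.2) ^ 2)) := by
    refine setIntegral_mono_on i0 ((i1.const_mul _).add i2) measurableSet_unitSquare fun a ha => ?_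
    rw [relDensity_trial hε ha hb]
    exact profileDensity_le hM hα hα' hε (by positivity)
  rw [integral_add (i1.const_mul _) i2, integral_const_mul] at h1
  exact h1.trans (add_le_add (mul_le_mul_of_nonneg_left l1 (by positivity)) l2)

lemma energy_trial_le {M : ℝ} (hM : ∀ x ∈ Set.Icc (0 : ℝ) 1, |deriv Real.smoothTransition x| ≤ M)
    {α ε : ℝ} (hα : 0 < α) (hα' : α ≤ 1) (hε : 0 < ε) :
    ∑ j, ∫ x in power 2 unitSquare, density α j (trial α ε) x
      ≤ 4 * Real.pi * α * 4 ^ α + 6 * Real.pi * (1 + 32 * M ^ 2) * ε ^ α := by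
  have h := setIntegral_setIntegral_le_const
    (e := fun a b => relDensity α b (fun a => trial α ε ![a, b]) a)
    ((isCore_trial α hε).continuous_relDensity α)
    fun b hb => slice_energy_trial_le hM hα hα' hε hb
  rw [(isCore_trial α hε).setIntegral_density]
  refine (mul_le_mul_of_nonneg_left h zero_le_two).trans_eq ?_
  rw [Real.rpow_sub_one hε.ne']
  field_simp
  ring

/-- Where the squared distance is at least `α`, the square of the trial function is at least `α^α`;
for each position of one particle the excluded disc has area `πα`. -/
lemma le_norm_trial {α ε : ℝ} (hα : 0 < α) (hε : 0 < ε) (hεα : 2 * ε ≤ α) :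
    α ^ α * (1 - Real.pi * α) ≤ ∫ x in power 2 unitSquare, ‖trial α ε x‖ ^ 2 := by
  have hcore := isCore_trial α hε
  have hc := hcore.smooth.continuous
  have hk0 : 0 < α ^ α := Real.rpow_pos_of_pos hα α
  have hnc : Continuous fun p : Plane × Plane => ‖trial α ε ![p.1, p.2]‖ ^ 2 :=
    ((hc.norm.pow 2)).comp continuous_pair
  have hslice : ∀ a ∈ unitSquare,
      α ^ α * (1 - Real.pi * α) ≤ ∫ b in unitSquare, ‖trial α ε ![a, b]‖ ^ 2 := fun a ha => by
    obtain ⟨i2, l2⟩ := setIntegral_indicator_near_le a (ρ := α) hα.le hk0.le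
    have i1 : IntegrableOn (fun _ : Plane => α ^ α) unitSquare :=
      continuous_const.continuousOn.integrableOn_compact isCompact_unitSquare
    have h1 : ∫ b in unitSquare, (α ^ α
          - (Set.Iio α).indicator (fun _ => α ^ α) ((b.1 - a.1) ^ 2 + (b.2 - a.2) ^ 2))
        ≤ ∫ b in unitSquare, ‖trial α ε ![a, b]‖ ^ 2 := by
      refine setIntegral_mono_on (i1.sub i2) ?_ measurableSet_unitSquare fun b hb => ?_
      · exact (hnc.comp (by fun_prop : Continuous fun b : Plane =>
          (a, b))).continuousOn.integrableOn_compact isCompact_unitSquare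
      · set t := (b.1 - a.1) ^ 2 + (b.2 - a.2) ^ 2 with ht
        rw [hcore.pair_symm, trial_pair hb ha, ← ht, Complex.norm_real, Real.norm_eq_abs, sq_abs]
        rcases lt_or_ge t α with h | h
        · rw [Set.indicator_of_mem (show t ∈ Set.Iio α from h), sub_self]
          positivity
        · rw [Set.indicator_of_notMem (show t ∉ Set.Iio α from not_lt.2 h), sub_zero,
            profile_of_ge hε (hεα.trans h), rpow_half_sq (hα.trans_le h)]
          exact Real.rpow_le_rpow hα.le h hα.le
    rw [integral_sub i1 i2, setIntegral_unitSquare_const] at h1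
    linarith
  rw [setIntegral_power (G := fun x => ‖trial α ε x‖ ^ 2) (by fun_prop)]
  exact const_le_setIntegral_setIntegral (n := fun a b => ‖trial α ε ![a, b]‖ ^ 2) hnc hslice

lemma exists_trial {α : ℝ} (hα : 0 < α) (hα' : α ≤ 1) :
    ∃ φ : Config 2 → ℂ, IsCore φ ∧
      ∑ j, ∫ x in power 2 unitSquare, density α j φ x ≤ 4 * Real.pi * α * 4 ^ α + α ^ 2 ∧
      α ^ α * (1 - Real.pi * α) ≤ ∫ x in power 2 unitSquare, ‖φ x‖ ^ 2 := by
  obtain ⟨M, hM⟩ := exists_abs_deriv_smoothTransition_le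
  have hpi := Real.pi_pos
  set C := 6 * Real.pi * (1 + 32 * M ^ 2) with hC
  have hC0 : 0 < C := by positivity
  -- The second entry makes the cutoff cost `C * ε ^ α` at most `α ^ 2`; the first gives `2 * ε ≤
  -- α`, as the norm bound needs.
  set ε := min (α / 2) ((α ^ 2 / C) ^ α⁻¹) with hε
  have hε0 : 0 < ε := by positivity
  have h1 : C * ε ^ α ≤ α ^ 2 := by
    have h2 : ε ^ α ≤ ((α ^ 2 / C) ^ α⁻¹) ^ α :=
      Real.rpow_le_rpow hε0.le (min_le_right _ _) hα.le
    rw [Real.rpow_inv_rpow (by positivity) hα.ne', le_div_iff₀ hC0] at h2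
    linarith
  refine ⟨trial α ε, isCore_trial α hε0, ?_, ?_⟩
  · exact (energy_trial_le hM hα hα' hε0).trans (by linarith)
  · exact le_norm_trial hα hε0 (by linarith [min_le_left (α / 2) ((α ^ 2 / C) ^ α⁻¹)])

/-! ### Asymptotics in the variable `x = α^{1/3}` -/

/-- From `log x ≥ 1 - 1/x` one gets `α log α ≥ -3x²` for `α = x³`: the logarithm costs less than the
admissible error `x`. -/
lemma one_sub_le_rpow_self {x : ℝ} (hx : 0 < x) : 1 - 3 * x ^ 2 ≤ (x ^ 3) ^ (x ^ 3) := by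
  have h1 : (x ^ 3) ^ (x ^ 3) = Real.exp (Real.log (x ^ 3) * x ^ 3) :=
    Real.rpow_def_of_pos (by positivity) _
  have h2 := Real.add_one_le_exp (Real.log (x ^ 3) * x ^ 3)
  have h3 : 1 - x⁻¹ ≤ Real.log x := Real.one_sub_inv_le_log_of_pos hx
  have h4 : -x⁻¹ ≤ Real.log x := by linarith
  have h5 : Real.log (x ^ 3) = 3 * Real.log x := by rw [Real.log_pow]; norm_num
  have h6 : -(3 * x ^ 2) ≤ Real.log (x ^ 3) * x ^ 3 := by
    calc -(3 * x ^ 2) = 3 * (-x⁻¹) * x ^ 3 := by field_simp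
      _ ≤ 3 * Real.log x * x ^ 3 := by gcongr
      _ = _ := by rw [h5]
  rw [h1]
  linarith

lemma four_rpow_le {α : ℝ} (hα : 0 ≤ α) (hα' : α ≤ 1) : (4 : ℝ) ^ α ≤ 1 + 3 * α := by
  have h := rpow_one_add_le_one_add_mul_self (s := 3) (by norm_num) hα hα'
  norm_num at h
  linarith

lemma one_sub_le_norm_bound {x : ℝ} (hx : 0 < x) (hx' : x ≤ 1 / 5) :
    1 - x ≤ (x ^ 3) ^ (x ^ 3) * (1 - Real.pi * x ^ 3) := by
  have h1 := one_sub_le_rpow_self hx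
  have h2 : Real.pi * x ^ 3 ≤ 4 * x ^ 3 := by
    gcongr
    exact Real.pi_lt_four.le
  have h3 : x ^ 2 ≤ x / 5 := by nlinarith
  have h4 : x ^ 3 ≤ x / 25 := by nlinarith
  have h5 : 0 ≤ 1 - 3 * x ^ 2 := by nlinarith
  have h6 : 0 ≤ 1 - 4 * x ^ 3 := by nlinarith
  calc 1 - x ≤ (1 - 3 * x ^ 2) * (1 - 4 * x ^ 3) := by
        have : 0 ≤ x ^ 2 * x ^ 3 := by positivity
        nlinarith
    _ ≤ (x ^ 3) ^ (x ^ 3) * (1 - Real.pi * x ^ 3) := by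
        gcongr

lemma neumannEnergy_upper {x : ℝ} (hx : 0 < x) (hx' : x ≤ 1 / 5) :
    neumannEnergy 2 (x ^ 3) ≤ 4 * Real.pi * x ^ 3 * (1 + 3 * x) := by
  have hpi := Real.pi_gt_three
  have hα : 0 < x ^ 3 := by positivity
  have h4 : x ^ 3 ≤ x / 25 := by nlinarith [mul_pos hx hx]
  have hα' : x ^ 3 ≤ 1 := by linarith
  obtain ⟨φ, hφ, hE, hN⟩ := exists_trial hα hα'
  have hN' := (one_sub_le_norm_bound hx hx').trans hN
  have hNpos : 0 < ∫ x in power 2 unitSquare, ‖φ x‖ ^ 2 := by linarith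
  refine (neumannEnergy_le hφ (x ^ 3) hNpos).trans ?_
  rw [div_le_iff₀ hNpos]
  have h5 := four_rpow_le hα.le hα'
  have hA : 0 < 4 * Real.pi * x ^ 3 := by positivity
  calc ∑ j, ∫ x_1 in power 2 unitSquare, density (x ^ 3) j φ x_1
      ≤ 4 * Real.pi * x ^ 3 * 4 ^ (x ^ 3) + (x ^ 3) ^ 2 := hE
    _ ≤ 4 * Real.pi * x ^ 3 * (1 + 3 * x ^ 3) + 4 * Real.pi * x ^ 3 * x ^ 3 := by
        have : (x ^ 3) ^ 2 ≤ 4 * Real.pi * x ^ 3 * x ^ 3 := by nlinarith [mul_pos hα hα]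
        gcongr
    _ = 4 * Real.pi * x ^ 3 * (1 + 4 * x ^ 3) := by ring
    -- The factor `1 - x` is split off to be absorbed by the lower bound on the norm.
    _ ≤ 4 * Real.pi * x ^ 3 * ((1 + 3 * x) * (1 - x)) := by
        gcongr
        nlinarith
    _ = 4 * Real.pi * x ^ 3 * (1 + 3 * x) * (1 - x) := by ring
    _ ≤ _ := by gcongr

lemma neumannEnergy_lower {x : ℝ} (hx : 0 < x) (hx' : x ≤ 1 / 5) :
    4 * Real.pi * x ^ 3 * (1 - 71 * x) ≤ neumannEnergy 2 (x ^ 3) := by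
  have hpi := Real.pi_pos
  have hpi4 := Real.pi_lt_four
  have hα : 0 < x ^ 3 := by positivity
  have h4 : x ^ 3 ≤ x / 25 := by nlinarith [mul_pos hx hx]
  obtain ⟨φ, hφ, -, hN⟩ := exists_trial hα (by linarith)
  have hNpos : 0 < ∫ x in power 2 unitSquare, ‖φ x‖ ^ 2 := by
    linarith [one_sub_le_norm_bound hx hx']
  set K := ((1 + x) * ((1 + x) / (2 * Real.pi * x ^ 3) + (1 + x⁻¹) * (4 / (Real.pi * x)))
          + (1 + x⁻¹) * 2) / 2 with hK
  have hKpos : 0 < K := by positivity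
  -- Both `R` and `δ` are taken equal to `x`.
  have h := le_neumannEnergy hφ hNpos hKpos (α := x ^ 3) (c := (1 - 2 * x) ^ 2) fun φ hφ =>
    hφ.lower_bound hα (by nlinarith) hx (by linarith) hx
  refine le_trans ?_ h
  rw [le_div_iff₀ hKpos]
  have hKeq : 4 * Real.pi * x ^ 3 * K
      = (1 + x) ^ 2 * (1 + 8 * x) + 4 * Real.pi * x ^ 2 * (1 + x) := by
    rw [hK]
    field_simp
    ring
  have hKle : 4 * Real.pi * x ^ 3 * K ≤ 1 + 67 * x := by
    rw [hKeq]
    have h1 : 4 * Real.pi * x ^ 2 * (1 + x) ≤ 4 * 4 * x ^ 2 * (1 + x) := by gcongr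
    have h2 : x ^ 2 ≤ x / 5 := by nlinarith
    nlinarith
  have hK0 : 0 ≤ 4 * Real.pi * x ^ 3 * K := by positivity
  -- The constant is `71 = 67 + 4`: `67` bounds the error in `K`, and `4` comes from `(1 - 2x)² ≥ 1
  -- - 4x`.
  calc 4 * Real.pi * x ^ 3 * (1 - 71 * x) * K
      = (4 * Real.pi * x ^ 3 * K) * (1 - 4 * x) - (4 * Real.pi * x ^ 3 * K) * (67 * x) := by ring
    _ ≤ (1 - 2 * x) ^ 2 := by
        have h1 : 1 ≤ 4 * Real.pi * x ^ 3 * K := by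
          rw [hKeq]
          have : 0 ≤ 4 * Real.pi * x ^ 2 * (1 + x) := by positivity
          have : 1 ≤ (1 + x) ^ 2 * (1 + 8 * x) := by nlinarith [mul_pos hx hx, pow_pos hx 3]
          linarith
        have h2 : (4 * Real.pi * x ^ 3 * K) * (1 - 4 * x) ≤ (1 + 67 * x) * (1 - 4 * x) := by
          gcongr
          linarith
        have h3 : 1 * (67 * x) ≤ (4 * Real.pi * x ^ 3 * K) * (67 * x) := by gcongr
        nlinarith

end Anyon

end

theorem mainTheorem4 :
    ∃ g : ℝ → ℝ,
      g =O[𝓝[>] (0 : ℝ)] (fun α : ℝ => α ^ (1 / 3 : ℝ)) ∧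
      ∀ᶠ α in 𝓝[>] (0 : ℝ),
        Anyon.neumannEnergy 2 α = 4 * Real.pi * α * (1 + g α) := by
  have hpi := Real.pi_pos
  refine ⟨fun α => Anyon.neumannEnergy 2 α / (4 * Real.pi * α) - 1, ?_, ?_⟩
  · refine IsBigO.of_bound 71 ?_
    -- The threshold `1 / 125` is the cube of `1 / 5`, the range of `x` in both bounds.
    filter_upwards [Ioo_mem_nhdsGT (show (0 : ℝ) < 1 / 125 by norm_num)] with α hα
    set x := α ^ (1 / 3 : ℝ) with hx
    have hx0 : 0 < x := Real.rpow_pos_of_pos hα.1 _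
    have hx3 : x ^ 3 = α := by
      rw [hx, ← Real.rpow_natCast, ← Real.rpow_mul hα.1.le]
      norm_num
    have hx5 : x ≤ 1 / 5 := by
      refine le_of_pow_le_pow_left₀ three_ne_zero (by norm_num) ?_
      rw [hx3]
      norm_num
      linarith [hα.2]
    have hup := Anyon.neumannEnergy_upper hx0 hx5
    have hlo := Anyon.neumannEnergy_lower hx0 hx5
    rw [hx3] at hup hlo
    have hA : 0 < 4 * Real.pi * α := mul_pos (by positivity) hα.1
    rw [Real.norm_eq_abs, Real.norm_eq_abs, abs_of_pos hx0, abs_le]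
    constructor
    · rw [le_sub_iff_add_le, le_div_iff₀ hA]
      linarith
    · rw [sub_le_iff_le_add, div_le_iff₀ hA]
      nlinarith [mul_pos hA hx0]
  · filter_upwards [self_mem_nhdsWithin] with α hα
    have hα0 : (0 : ℝ) < α := hα
    field_simp
    ring
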